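/- All vector spaces are over $\mathbb C$; $\mathrm{Mat}_n$ is the algebra of $n\times n$ complex matrices. A bilinear associative product $\circ$ on $\mathrm{Mat}_n$ is *compatible* with the matrix product if $xy+\lambda\,x\circ y$ is an associative product for every $\lambda\in\mathbb C$. **$M$-structures.** A *weak $M$-structure* is a finite-dimensional vector space $\mathcal L$ with two subspaces $\mathcal A,\mathcal B$, an element $1\in\mathcal A\cap\mathcal B$, a non-degenerate symmetric bilinear form $(\cdot,\cdot)$ on $\mathcal L$, associative products on $\mathcal A$ and on $\mathcal B$ with unity $1$, and commuting unital actions, a left action of $\mathcal B$ on $\mathcal L$ and a right action of $\mathcal A$ on $\mathcal L$, such that: 1. $\dim(\mathcal A\cap\mathcal B)=\dim\mathcal L/(\mathcal A+\mathcal B)=1$ and $\mathcal A\cap\mathcal B=\mathbb C1$; 2. the actions restricted to $\mathcal B$, respectively to $\mathcal A$, are the products of $\mathcal B$, respectively of $\mathcal A$; 3. $(a_1,a_2)=(b_1,b_2)=0$, $(b_1b_2,v)=(b_1,b_2v)$ and $(v,a_1a_2)=(va_1,a_2)$ for all $a_1,a_2\in\mathcal A$, $b_1,b_2\in\mathcal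 B$, $v\in\mathcal L$. Its algebra $U(\mathcal L)$ is the universal unital associative algebra generated by $\mathcal L$ in which $1\in\mathcal L$ is the unity and the two actions are given by multiplication. One can choose bases $1,A_1,\dots,A_p$ of $\mathcal A$ and $1,B^1,\dots,B^p$ of $\mathcal B$ with $(A_i,B^j)=\delta_i^j$, and $C\in\mathcal L$ with $(1,C)=1$ and $(C,C)=(C,A_i)=(C,B^j)=0$; call such a choice a *frame*. The element $K=\sum_iA_iB^i+C\in U(\mathcal L)$ does not depend on the frame, and $\mathcal L$ is an *$M$-structure* if $K$ is central in $U(\mathcal L)$. An *equivalence* of $M$-structures is a linear isomorphism preserving all the data. **Representations.** An $n$-dimensional representation of $U(\mathcal L)$ is a homomorphism of unital algebras $\rho:U(\mathcal L)\to\mathrm{Mat}_n$. Write $a_i=\rho(A_i)$, $b^i=\rho(B^i)$, $c=\rho(C)$. The representation is *non-degenerate* if $1,a_1,\dots,a_p$ are linearly independent and $1,b^1,\dots,b^p$ are linearly independent. Two pairs $(\mathcal L,\rho)$ and $(\mathcal L',\rho')$ are identified if there is an equivalence $f:\mathcal L\to\mathcal L'$ of $M$-structures with $\rho'(f(v))=\rho(v)$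 for all $v\in\mathcal L$. **Theorem 2.3.** Let $n\ge1$. Sending $(\mathcal L,\rho)$ to the product $$x\circ y=\sum_{i=1}^p\bigl(a_i\,x\,b^i\,y+x\,a_i\,y\,b^i-a_i\,x\,y\,b^i\bigr)+x\,c\,y ,$$ which does not depend on the frame, gives a one-to-one correspondence between the $n$-dimensional non-degenerate representations of the algebras $U(\mathcal L)$ of $M$-structures $\mathcal L$, up to equivalence of $M$-structures, and the associative products on $\mathrm{Mat}_n$ compatible with the matrix product. -/

import Mathlib

universe u v w

/-! ### Associative and compatible products -/

/-- A product on the vector space `V`: a bilinear map `V × V → V`. -/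
abbrev BilinearProduct (V : Type u) [AddCommGroup V] [Module ℂ V] : Type u :=
  V →ₗ[ℂ] V →ₗ[ℂ] V

/-- Associativity of a product. -/
def BilinearProduct.IsAssociative {V : Type u} [AddCommGroup V] [Module ℂ V]
    (m : BilinearProduct V) : Prop :=
  ∀ x y z : V, m (m x y) z = m x (m y z)

/-- Two products are compatible if all the products `x ⋆ y + t • (x ∘ y)`, `t ∈ ℂ`,
are associative. -/
def BilinearProduct.IsCompatible {V : Type u} [AddCommGroup V] [Module ℂ V]
    (s m : BilinearProduct V) : Prop :=
  ∀ t : ℂ, BilinearProduct.IsAssociative (s + t • m)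

/-- The usual matrix product on `Mat_n`. -/
noncomputable def matrixProduct (n : ℕ) : BilinearProduct (Matrix (Fin n) (Fin n) ℂ) :=
  LinearMap.mul ℂ (Matrix (Fin n) (Fin n) ℂ)

/-- The associative products on `Mat_n` that are compatible with the usual matrix product. -/
def CompatibleMatrixProduct (n : ℕ) : Type :=
  {m : BilinearProduct (Matrix (Fin n) (Fin n) ℂ) //
    m.IsAssociative ∧ (matrixProduct n).IsCompatible m}

/-! ### Weak `M`-structures -/

/-- A weak `M`-structure on a complex vector space `L`. -/
structure WeakMStructure (L : Type u) [AddCommGroup L] [Module ℂ L] where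
  /-- the subspace `𝒜` -/
  subA : Submodule ℂ L
  /-- the subspace `ℬ` -/
  subB : Submodule ℂ L
  /-- the distinguished element `1` -/
  unit : L
  /-- the scalar product on `L` -/
  form : L →ₗ[ℂ] L →ₗ[ℂ] ℂ
  /-- the product of `𝒜` -/
  mulA : BilinearProduct subA
  /-- the product of `ℬ` -/
  mulB : BilinearProduct subB
  /-- the left action `ℬ × L → L` -/
  lact : subB →ₗ[ℂ] L →ₗ[ℂ] L
  /-- the right action `L × 𝒜 → L` -/
  ract : L →ₗ[ℂ] subA →ₗ[ℂ] L
  unit_mem_subA : unit ∈ subA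
  unit_mem_subB : unit ∈ subB
  form_symm : ∀ v v' : L, form v v' = form v' v
  form_nondegenerate : ∀ v : L, (∀ v' : L, form v v' = 0) → v = 0
  mulA_assoc : mulA.IsAssociative
  unit_mulA : ∀ a : subA, mulA ⟨unit, unit_mem_subA⟩ a = a
  mulA_unit : ∀ a : subA, mulA a ⟨unit, unit_mem_subA⟩ = a
  mulB_assoc : mulB.IsAssociative
  unit_mulB : ∀ b : subB, mulB ⟨unit, unit_mem_subB⟩ b = b
  mulB_unit : ∀ b : subB, mulB b ⟨unit, unit_mem_subB⟩ = b
  unit_lact : ∀ v : L, lact ⟨unit, unit_mem_subB⟩ v = v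
  mulB_lact : ∀ (b b' : subB) (v : L), lact (mulB b b') v = lact b (lact b' v)
  ract_unit : ∀ v : L, ract v ⟨unit, unit_mem_subA⟩ = v
  ract_mulA : ∀ (v : L) (a a' : subA), ract v (mulA a a') = ract (ract v a) a'
  act_comm : ∀ (b : subB) (v : L) (a : subA), ract (lact b v) a = lact b (ract v a)
  finrank_inf : Module.finrank ℂ ↥(subA ⊓ subB) = 1
  finrank_quot : Module.finrank ℂ (L ⧸ (subA ⊔ subB)) = 1
  inf_eq_span : subA ⊓ subB = Submodule.span ℂ {unit}
  lact_eq_mulB : ∀ b b' : subB, lact b b' = mulB b b'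
  ract_eq_mulA : ∀ a a' : subA, ract a a' = mulA a a'
  form_subA : ∀ a a' : subA, form a a' = 0
  form_subB : ∀ b b' : subB, form b b' = 0
  form_mulB : ∀ (b b' : subB) (v : L), form (mulB b b') v = form b (lact b' v)
  form_mulA : ∀ (v : L) (a a' : subA), form v (mulA a a') = form (ract v a) a'

namespace WeakMStructure

section Algebra

variable {L : Type u} [AddCommGroup L] [Module ℂ L] (S : WeakMStructure L)

/-- The defining relations of `U(L)`: the element `1 ∈ L` is the unity, and the two actions are
restrictions of the product. -/
inductive Rel : TensorAlgebra ℂ L → TensorAlgebra ℂ L → Prop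
  | unit : Rel (TensorAlgebra.ι ℂ S.unit) 1
  | lact (b : S.subB) (v : L) :
      Rel (TensorAlgebra.ι ℂ (b : L) * TensorAlgebra.ι ℂ v) (TensorAlgebra.ι ℂ (S.lact b v))
  | ract (v : L) (a : S.subA) :
      Rel (TensorAlgebra.ι ℂ v * TensorAlgebra.ι ℂ (a : L)) (TensorAlgebra.ι ℂ (S.ract v a))

/-- The weak `M`-algebra `U(L)`: the universal unital associative algebra generated by `L`
in which `1 ∈ L` is the unity and the two actions are given by multiplication. -/
abbrev U : Type u := RingQuot S.Rel

/-- The canonical map `L → U(L)`. -/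
noncomputable def toU : L →ₗ[ℂ] S.U :=
  (RingQuot.mkAlgHom ℂ S.Rel).toLinearMap ∘ₗ TensorAlgebra.ι ℂ

theorem toU_unit : S.toU S.unit = 1 := by
  have h := RingQuot.mkAlgHom_rel ℂ (Rel.unit (S := S))
  simpa [toU] using h

theorem toU_lact (b : S.subB) (v : L) : S.toU (S.lact b v) = S.toU b * S.toU v := by
  have h := RingQuot.mkAlgHom_rel ℂ (Rel.lact (S := S) b v)
  simpa [toU] using h.symm

theorem toU_ract (v : L) (a : S.subA) : S.toU (S.ract v a) = S.toU v * S.toU a := by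
  have h := RingQuot.mkAlgHom_rel ℂ (Rel.ract (S := S) v a)
  simpa [toU] using h.symm

/-- The universal property of `U(L)`. -/
theorem existsUnique_lift {X : Type v} [Ring X] [Algebra ℂ X] (f : L →ₗ[ℂ] X)
    (h1 : f S.unit = 1) (hl : ∀ (b : S.subB) (v : L), f (S.lact b v) = f b * f v)
    (hr : ∀ (v : L) (a : S.subA), f (S.ract v a) = f v * f a) :
    ∃! φ : S.U →ₐ[ℂ] X, ∀ v : L, φ (S.toU v) = f v := by
  refine ⟨RingQuot.liftAlgHom ℂ ⟨TensorAlgebra.lift ℂ f, ?_⟩, ?_, ?_⟩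
  · intro x y hxy
    cases hxy with
    | unit => simp [h1]
    | lact b v => simp [hl]
    | ract v a => simp [hr]
  · intro v
    simp [toU]
  · intro ψ hψ
    apply RingQuot.ringQuot_ext'
    apply TensorAlgebra.hom_ext
    ext v
    simpa [toU] using hψ v

/-- A choice of a basis `1, A_1, …, A_p` of `𝒜`, of the dual basis `1, B^1, …, B^p` of `ℬ`,
and of the corresponding element `C`. -/
structure Frame where
  p : ℕ
  A : Fin p → L
  B : Fin p → L
  C : L
  linearIndependent_A : LinearIndependent ℂ (Fin.cons S.unit A : Fin (p + 1) → L)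
  span_A : Submodule.span ℂ (Set.range (Fin.cons S.unit A : Fin (p + 1) → L)) = S.subA
  linearIndependent_B : LinearIndependent ℂ (Fin.cons S.unit B : Fin (p + 1) → L)
  span_B : Submodule.span ℂ (Set.range (Fin.cons S.unit B : Fin (p + 1) → L)) = S.subB
  form_A_B : ∀ i j, S.form (A i) (B j) = if i = j then 1 else 0
  form_unit_C : S.form S.unit C = 1
  form_C_A : ∀ i, S.form C (A i) = 0
  form_C_B : ∀ i, S.form C (B i) = 0
  form_C_C : S.form C C = 0

variable {S}

/-- The element `K = ∑ A_i B^i + C` of `U(L)`. -/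
noncomputable def Frame.K (F : S.Frame) : S.U :=
  ∑ i, S.toU (F.A i) * S.toU (F.B i) + S.toU F.C

variable (S)

/-- A weak `M`-structure is an `M`-structure if `K` is central in `U(L)`
(`K` does not depend on the frame). -/
def IsMStructure : Prop :=
  ∀ F : S.Frame, F.K ∈ Subalgebra.center ℂ S.U

variable {S}

/-- A representation of `U(L)` is non-degenerate if the matrices `1, a_1, …, a_p` are linearly
independent and the matrices `1, b^1, …, b^p` are linearly independent
(this does not depend on the frame). -/
def IsNondegenerate {n : ℕ} (ρ : S.U →ₐ[ℂ] Matrix (Fin n) (Fin n) ℂ) : Prop :=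
  ∀ F : S.Frame,
    LinearIndependent ℂ
      (Fin.cons 1 (fun i => ρ (S.toU (F.A i))) : Fin (F.p + 1) → Matrix (Fin n) (Fin n) ℂ) ∧
    LinearIndependent ℂ
      (Fin.cons 1 (fun i => ρ (S.toU (F.B i))) : Fin (F.p + 1) → Matrix (Fin n) (Fin n) ℂ)

/-- The value at `(x, y)` of the product
`x ∘ y = a_i x b^i y + x a_i y b^i - a_i x y b^i + x c y` defined by a representation of `U(L)`. -/
noncomputable def Frame.product (F : S.Frame) {n : ℕ}
    (ρ : S.U →ₐ[ℂ] Matrix (Fin n) (Fin n) ℂ) (x y : Matrix (Fin n) (Fin n) ℂ) :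
    Matrix (Fin n) (Fin n) ℂ :=
  ∑ i, (ρ (S.toU (F.A i)) * x * ρ (S.toU (F.B i)) * y
      + x * ρ (S.toU (F.A i)) * y * ρ (S.toU (F.B i))
      - ρ (S.toU (F.A i)) * x * y * ρ (S.toU (F.B i)))
    + x * ρ (S.toU F.C) * y

end Algebra

section Iso

variable {L : Type u} [AddCommGroup L] [Module ℂ L]
  {L' : Type v} [AddCommGroup L'] [Module ℂ L']
  {L'' : Type w} [AddCommGroup L''] [Module ℂ L'']

/-- Equivalences (isomorphisms) of weak `M`-structures: linear isomorphisms preserving all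
the data. -/
structure Iso (S : WeakMStructure L) (S' : WeakMStructure L') extends L ≃ₗ[ℂ] L' where
  mem_subA : ∀ v : L, v ∈ S.subA ↔ toLinearEquiv v ∈ S'.subA
  mem_subB : ∀ v : L, v ∈ S.subB ↔ toLinearEquiv v ∈ S'.subB
  map_unit : toLinearEquiv S.unit = S'.unit
  map_form : ∀ v v' : L, S'.form (toLinearEquiv v) (toLinearEquiv v') = S.form v v'
  map_mulA : ∀ a a' : S.subA, toLinearEquiv (S.mulA a a' : L) =
    S'.mulA ⟨toLinearEquiv a, (mem_subA a).1 a.2⟩ ⟨toLinearEquiv a', (mem_subA a').1 a'.2⟩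
  map_mulB : ∀ b b' : S.subB, toLinearEquiv (S.mulB b b' : L) =
    S'.mulB ⟨toLinearEquiv b, (mem_subB b).1 b.2⟩ ⟨toLinearEquiv b', (mem_subB b').1 b'.2⟩
  map_lact : ∀ (b : S.subB) (v : L), toLinearEquiv (S.lact b v) =
    S'.lact ⟨toLinearEquiv b, (mem_subB b).1 b.2⟩ (toLinearEquiv v)
  map_ract : ∀ (v : L) (a : S.subA), toLinearEquiv (S.ract v a) =
    S'.ract (toLinearEquiv v) ⟨toLinearEquiv a, (mem_subA a).1 a.2⟩

/-- The identity equivalence. -/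
def Iso.refl (S : WeakMStructure L) : Iso S S where
  toLinearEquiv := LinearEquiv.refl ℂ L
  mem_subA _ := Iff.rfl
  mem_subB _ := Iff.rfl
  map_unit := rfl
  map_form _ _ := rfl
  map_mulA _ _ := rfl
  map_mulB _ _ := rfl
  map_lact _ _ := rfl
  map_ract _ _ := rfl

/-- The inverse of an equivalence. -/
def Iso.symm {S : WeakMStructure L} {S' : WeakMStructure L'} (e : Iso S S') : Iso S' S where
  toLinearEquiv := e.toLinearEquiv.symm
  mem_subA v := by simp [e.mem_subA]
  mem_subB v := by simp [e.mem_subB]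
  map_unit := by simp [← e.map_unit]
  map_form v v' := by simp [← e.map_form]
  map_mulA a a' := by
    apply e.toLinearEquiv.injective
    simp [e.map_mulA]
  map_mulB b b' := by
    apply e.toLinearEquiv.injective
    simp [e.map_mulB]
  map_lact b v := by
    apply e.toLinearEquiv.injective
    simp [e.map_lact]
  map_ract v a := by
    apply e.toLinearEquiv.injective
    simp [e.map_ract]

/-- The composition of equivalences. -/
def Iso.trans {S : WeakMStructure L} {S' : WeakMStructure L'} {S'' : WeakMStructure L''}
    (e : Iso S S') (f : Iso S' S'') : Iso S S'' where
  toLinearEquiv := e.toLinearEquiv.trans f.toLinearEquiv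
  mem_subA v := by simp [e.mem_subA, f.mem_subA]
  mem_subB v := by simp [e.mem_subB, f.mem_subB]
  map_unit := by simp [e.map_unit, f.map_unit]
  map_form v v' := by simp [e.map_form, f.map_form]
  map_mulA a a' := by simp [e.map_mulA, f.map_mulA]
  map_mulB b b' := by simp [e.map_mulB, f.map_mulB]
  map_lact b v := by simp [e.map_lact, f.map_lact]
  map_ract v a := by simp [e.map_ract, f.map_ract]

end Iso

end WeakMStructure

/-! ### Non-degenerate representations of `M`-algebras, up to equivalence -/

/-- A finite-dimensional `M`-structure `L` together with an `n`-dimensional non-degenerate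
representation `U(L) → Mat_n`. -/
structure NondegenerateMRep (n : ℕ) where
  L : Type u
  [addCommGroup : AddCommGroup L]
  [module : Module ℂ L]
  [finiteDimensional : FiniteDimensional ℂ L]
  str : WeakMStructure L
  isMStructure : str.IsMStructure
  rep : str.U →ₐ[ℂ] Matrix (Fin n) (Fin n) ℂ
  isNondegenerate : WeakMStructure.IsNondegenerate rep

attribute [instance] NondegenerateMRep.addCommGroup NondegenerateMRep.module
  NondegenerateMRep.finiteDimensional

/-- Two representations are identified if they correspond to each other under an equivalence of
`M`-structures. -/
def NondegenerateMRep.Equivalent {n : ℕ} (X : NondegenerateMRep.{u} n)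
    (Y : NondegenerateMRep.{u} n) : Prop :=
  ∃ e : WeakMStructure.Iso X.str Y.str,
    ∀ v : X.L, Y.rep (Y.str.toU (e.toLinearEquiv v)) = X.rep (X.str.toU v)

/-- Equivalence of representations as an equivalence relation. -/
def NondegenerateMRep.setoid (n : ℕ) : Setoid (NondegenerateMRep.{u} n) where
  r := NondegenerateMRep.Equivalent
  iseqv :=
    { refl := fun X => ⟨WeakMStructure.Iso.refl X.str, fun _ => rfl⟩
      symm := by
        rintro X Y ⟨e, he⟩
        refine ⟨e.symm, fun v => ?_⟩
        rw [← he]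
        simp [WeakMStructure.Iso.symm]
      trans := by
        rintro X Y Z ⟨e, he⟩ ⟨f, hf⟩
        refine ⟨e.trans f, fun v => ?_⟩
        rw [← he, ← hf]
        simp [WeakMStructure.Iso.trans] }

/-!
The second Hochschild cohomology of `Mat_n` vanishes, so a product compatible with the matrix
product is the coboundary `R x * y + x * R y - R (x * y)` of an operator `R`, which is unique up to
inner derivations (`exists_eq_coboundary`, `exists_sub_eq_commutator`). Every operator is a sum of
operators `x ↦ u * x * w`; modulo inner derivations, `R x = ∑ aᵢ x bⁱ + c x`, where the families
`1, a₁, …, aₚ` and `1, b¹, …, bᵖ` are independent (`exists_eq_coboundary_frameMap`). The coboundary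
of this `R` is the product of the theorem.

The product is associative if and only if the obstruction `N x y = R x * R y - R (x ∘ y)` is a
cocycle (`isAssociative_coboundary_iff`). A cocycle on `Mat_n` is a coboundary, so
contracting its outer slots with functionals that vanish at `1` leaves a multiple of `1`. This
yields structure constants for `aᵢ aⱼ`, `bⁱ bʲ` and `bⁱ aⱼ` (`exists_holds`). Given these
relations, `N` is explicitly a coboundary plus terms linear in the commutators of `∑ aᵢ bⁱ + c` with
the `aⱼ` and the `bʲ` (`MConstants.Holds.obstruction_eq`), so that associativity amounts to the
vanishing of these commutators (`MConstants.Holds.isAssociative`,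
`MConstants.Holds.defect_eq_zero`). This is the centrality of `K`.

An associative product thus has relations with structure constants, and these define an
`M`-structure on a space with basis `1, Aᵢ, Bⁱ, C` (`MCoordinates.toWeakMStructure`). The image of
this space in `Mat_n` may be smaller, but a vector is determined by its image in `Mat_n` together
with its pairing with `𝒜`, since `𝒜` is its own orthogonal complement and is embedded into `Mat_n`
(`MCoordinates.eq_of_rep_of_form_subA`). Hence the axioms follow from the associativity of `Mat_n`
and the invariance of the form. The same principle shows that an isomorphism respecting frames and
their images preserves the products and the actions (`WeakMStructure.IsFrame.exists_iso`). Such an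
isomorphism exists if two representations define the same product: contracting the difference of
the two operators, an inner derivation, shows that the spans of the `1, aᵢ` and of the `1, bⁱ`
coincide and that the pairings between them agree (`exists_transition`). Independence of the frame
is the invariance of the tensor of the form (`WeakMStructure.IsFrame.sum_bilin`).
-/

/-! ### Coboundaries and the associativity of the product they define -/

section Coboundary

variable {X : Type*} [Ring X] [Algebra ℂ X]

/-- The Hochschild coboundary `(x, y) ↦ R x * y + x * R y - R (x * y)` of a linear map `R`. -/
noncomputable def coboundary (R : X →ₗ[ℂ] X) : BilinearProduct X :=
  LinearMap.mul ℂ X ∘ₗ R + (LinearMap.mul ℂ X).compl₂ R - (LinearMap.mul ℂ X).compr₂ R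

theorem coboundary_apply (R : X →ₗ[ℂ] X) (x y : X) :
    coboundary R x y = R x * y + x * R y - R (x * y) := rfl

/-- The Hochschild cocycle condition for a function of two variables. -/
def IsTwoCocycle (f : X → X → X) : Prop :=
  ∀ x y z : X, x * f y z - f (x * y) z + f x (y * z) - f x y * z = 0

theorem isTwoCocycle_coboundary (R : X →ₗ[ℂ] X) :
    IsTwoCocycle fun x y => coboundary R x y := by
  intro x y z
  simp only [coboundary_apply, mul_assoc]
  noncomm_ring

/-- The failure of `R` to be multiplicative from the product `coboundary R` to the
product of `X`. -/
noncomputable def obstruction (R : X →ₗ[ℂ] X) (x y : X) : X :=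
  R x * R y - R (coboundary R x y)

/-- The associator of `coboundary R` is the Hochschild coboundary of the obstruction. -/
theorem isAssociative_coboundary_iff (R : X →ₗ[ℂ] X) :
    (coboundary R).IsAssociative ↔ IsTwoCocycle (obstruction R) := by
  have key : ∀ x y z : X,
      x * obstruction R y z - obstruction R (x * y) z + obstruction R x (y * z)
        - obstruction R x y * z
      = coboundary R (coboundary R x y) z - coboundary R x (coboundary R y z) := by
    intro x y z
    simp only [obstruction, coboundary_apply, mul_assoc, map_add, map_sub, mul_add, add_mul,
      mul_sub, sub_mul, LinearMap.add_apply, LinearMap.sub_apply]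
    abel
  constructor
  · intro h x y z
    rw [key, h, sub_self]
  · intro h x y z
    rw [← sub_eq_zero, ← key]
    exact h x y z

end Coboundary

/-! ### The operator `x ↦ ∑ aᵢ x bⁱ + c x` and its structure constants -/

/-- The structure constants of the products `aᵢ aⱼ`, `bⁱ bʲ` and `bⁱ aⱼ`; here `phi k i j` is the
coefficient of `aₖ` in `aᵢ aⱼ` and `psi i j k` is that of `bᵏ` in `bⁱ bʲ`; the coefficients of `1`
in `aᵢ aⱼ`, `bⁱ bʲ` and `bⁱ aⱼ` are `mu i j`, `lam i j` and `t i j`. -/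
structure MConstants (p : ℕ) where
  phi : Fin p → Fin p → Fin p → ℂ
  mu : Fin p → Fin p → ℂ
  psi : Fin p → Fin p → Fin p → ℂ
  lam : Fin p → Fin p → ℂ
  t : Fin p → Fin p → ℂ

section Relations

variable {X : Type*} [Ring X] [Algebra ℂ X] {p : ℕ}

/-- The linear map `x ↦ ∑ aᵢ x bⁱ + c x`. -/
noncomputable def frameMap (a b : Fin p → X) (c : X) : X →ₗ[ℂ] X :=
  ∑ i, LinearMap.mulLeftRight ℂ (a i, b i) + LinearMap.mulLeft ℂ c

theorem frameMap_apply (a b : Fin p → X) (c x : X) :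
    frameMap a b c x = ∑ i, a i * x * b i + c * x := by
  simp [frameMap]

/-- The elements `aᵢ, bⁱ, c` multiply with the given structure constants. -/
structure MConstants.Holds (s : MConstants p) (a b : Fin p → X) (c : X) : Prop where
  a_mul_a : ∀ i j, a i * a j = ∑ k, s.phi k i j • a k + s.mu i j • (1 : X)
  b_mul_b : ∀ i j, b i * b j = ∑ k, s.psi i j k • b k + s.lam i j • (1 : X)
  b_mul_a : ∀ i j, b i * a j = ∑ k, s.psi k i j • a k + ∑ k, s.phi i j k • b k
    + s.t i j • (1 : X) + if i = j then c else 0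

/-- The expression for the commutator of `∑ aᵢ bⁱ + c` and `aⱼ` through the structure
constants. -/
noncomputable def MConstants.defectA (s : MConstants p) (a b : Fin p → X) (c : X) (j : Fin p) : X :=
  ∑ i, ∑ k, s.psi k i j • (a i * a k) + ∑ i, s.t i j • a i + (c * a j - ∑ k, s.mu j k • b k)

/-- The expression for the commutator of `bʲ` and `∑ aᵢ bⁱ + c` through the structure
constants. -/
noncomputable def MConstants.defectB (s : MConstants p) (a b : Fin p → X) (c : X) (j : Fin p) : X :=
  ∑ i, ∑ k, s.phi j i k • (b k * b i) + ∑ i, s.t j i • b i + (b j * c - ∑ k, s.lam k j • a k)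

variable {s : MConstants p} {a b : Fin p → X} {c : X}

theorem MConstants.Holds.commutator_a (h : s.Holds a b c) (j : Fin p) :
    (∑ i, a i * b i + c) * a j - a j * (∑ i, a i * b i + c) = s.defectA a b c j := by
  have h1 : ∑ i, a i * (b i * a j) = ∑ i, ∑ k, s.psi k i j • (a i * a k)
      + ∑ i, ∑ k, s.phi i j k • (a i * b k) + ∑ i, s.t i j • a i + a j * c := by
    simp only [h.b_mul_a, mul_add, Finset.mul_sum, mul_smul_comm, mul_one, mul_ite, mul_zero,
      Finset.sum_add_distrib, Finset.sum_ite_eq', Finset.mem_univ, if_true]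
  have h2 : ∑ i, a j * a i * b i = ∑ i, ∑ k, s.phi i j k • (a i * b k)
      + ∑ i, s.mu j i • b i := by
    simp only [h.a_mul_a, add_mul, Finset.sum_mul, smul_mul_assoc, one_mul,
      Finset.sum_add_distrib]
    rw [Finset.sum_comm]
  rw [add_mul, mul_add, Finset.sum_mul, Finset.mul_sum]
  simp only [← mul_assoc (a j)]
  rw [h2]
  simp only [mul_assoc]
  rw [h1, MConstants.defectA]
  abel

theorem MConstants.Holds.commutator_b (h : s.Holds a b c) (j : Fin p) :
    b j * (∑ i, a i * b i + c) - (∑ i, a i * b i + c) * b j = s.defectB a b c j := by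
  have h1 : ∑ i, b j * a i * b i = ∑ i, ∑ k, s.psi k j i • (a k * b i)
      + ∑ i, ∑ k, s.phi j i k • (b k * b i) + ∑ i, s.t j i • b i + c * b j := by
    simp only [h.b_mul_a, add_mul, Finset.sum_mul, smul_mul_assoc, one_mul, ite_mul, zero_mul,
      Finset.sum_add_distrib, Finset.sum_ite_eq, Finset.mem_univ, if_true]
  have h2 : ∑ i, a i * (b i * b j) = ∑ i, ∑ k, s.psi k j i • (a k * b i)
      + ∑ i, s.lam i j • a i := by
    simp only [h.b_mul_b, mul_add, Finset.mul_sum, mul_smul_comm, mul_one,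
      Finset.sum_add_distrib]
    rw [Finset.sum_comm]
  rw [add_mul, mul_add, Finset.sum_mul, Finset.mul_sum]
  simp only [← mul_assoc (b j)]
  rw [h1]
  simp only [mul_assoc]
  rw [h2, MConstants.defectB]
  abel

/-- The obstruction of `frameMap a b c` as a sum of terms `u * x * v * y * w`. -/
theorem obstruction_frameMap (a b : Fin p → X) (c x y : X) :
    obstruction (frameMap a b c) x y =
      ∑ i, ∑ j, a i * x * (b i * a j) * y * b j + ∑ i, a i * x * (b i * c) * y
      - ∑ i, ∑ j, a j * a i * x * b i * y * b j - ∑ i, ∑ j, a j * x * a i * y * (b i * b j)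
      + ∑ i, ∑ j, a j * a i * x * y * (b i * b j) - ∑ i, a i * x * c * y * b i
      - ∑ i, c * a i * x * b i * y + ∑ i, c * a i * x * y * b i := by
  simp only [obstruction, coboundary_apply, frameMap_apply, mul_add, add_mul, mul_sub, sub_mul,
    Finset.sum_mul, Finset.mul_sum, Finset.sum_add_distrib, Finset.sum_sub_distrib, mul_assoc]
  rw [Finset.sum_comm (f := fun i j => a i * (x * (b i * (a j * (y * b j))))),
    Finset.sum_comm (f := fun i j => a j * (a i * (x * (b i * (y * b j))))),
    Finset.sum_comm (f := fun i j => a j * (x * (a i * (y * (b i * b j))))),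
    Finset.sum_comm (f := fun i j => a j * (a i * (x * (y * (b i * b j)))))]
  abel

theorem MConstants.Holds.sum_defectA (h : s.Holds a b c) (z : X) :
    ∑ j, s.defectA a b c j * z * b j =
      ∑ i, ∑ j, a j * a i * z * (b i * b j) - ∑ i, ∑ j, s.lam i j • (a j * a i * z)
      + ∑ i, ∑ j, s.t i j • (a i * z * b j) + ∑ j, c * a j * z * b j
      - ∑ j, ∑ k, s.mu j k • (b k * z * b j) := by
  have h1 : ∑ j, ∑ i, ∑ k, s.psi k i j • (a i * a k * z * b j) =
      ∑ i, ∑ j, a j * a i * z * (b i * b j) - ∑ i, ∑ j, s.lam i j • (a j * a i * z) := by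
    rw [eq_sub_iff_add_eq]
    simp only [h.b_mul_b, mul_add, Finset.mul_sum, mul_smul_comm, mul_one,
      Finset.sum_add_distrib]
    rw [Finset.sum_comm, Finset.sum_comm (s := Finset.univ) (t := Finset.univ)
      (f := fun i k => ∑ l, s.psi i k l • (a k * a i * z * b l))]
    congr 1
    refine Finset.sum_congr rfl fun i _ => ?_
    rw [Finset.sum_comm]
  rw [← h1, Finset.sum_comm (f := fun i j => s.t i j • (a i * z * b j))]
  simp only [MConstants.defectA, add_mul, sub_mul, Finset.sum_mul, smul_mul_assoc,
    Finset.sum_add_distrib, Finset.sum_sub_distrib]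
  abel

theorem MConstants.Holds.sum_defectB (h : s.Holds a b c) (z : X) :
    ∑ j, a j * z * s.defectB a b c j =
      ∑ i, ∑ j, a j * a i * z * (b i * b j) - ∑ i, ∑ k, s.mu i k • (z * (b k * b i))
      + ∑ i, ∑ j, s.t i j • (a i * z * b j) + ∑ j, a j * z * (b j * c)
      - ∑ i, ∑ j, s.lam i j • (a j * z * a i) := by
  have h1 : ∑ j, ∑ i, ∑ k, s.phi j i k • (a j * z * (b k * b i)) =
      ∑ i, ∑ j, a j * a i * z * (b i * b j) - ∑ i, ∑ k, s.mu i k • (z * (b k * b i)) := by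
    rw [eq_sub_iff_add_eq, Finset.sum_comm (f := fun i j => a j * a i * z * (b i * b j))]
    simp only [h.a_mul_a, add_mul, Finset.sum_mul, smul_mul_assoc, one_mul,
      Finset.sum_add_distrib]
    congr 1
    rw [Finset.sum_comm]
    refine Finset.sum_congr rfl fun i _ => ?_
    rw [Finset.sum_comm]
  rw [← h1, Finset.sum_comm (f := fun i j => s.lam i j • (a j * z * a i))]
  simp only [MConstants.defectB, mul_add, mul_sub, Finset.mul_sum, mul_smul_comm,
    Finset.sum_add_distrib, Finset.sum_sub_distrib]
  abel

/-- Up to a coboundary, the obstruction is expressed through the commutators of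
`∑ aᵢ bⁱ + c` with the `aⱼ` and the `bʲ`. -/
theorem MConstants.Holds.obstruction_eq (h : s.Holds a b c) (x y : X) :
    obstruction (frameMap a b c) x y =
      coboundary (LinearMap.mulLeft ℂ (∑ i, ∑ k, s.mu i k • (b k * b i))
        - ∑ j, ∑ i, s.mu j i • LinearMap.mulLeftRight ℂ (b i, b j)) x y
      + ∑ j, (s.defectA a b c j * (x * y) * b j - s.defectA a b c j * x * b j * y
        + a j * x * s.defectB a b c j * y) := by
  have h1 : ∑ i, ∑ j, a i * x * (b i * a j) * y * b j =
      ∑ i, ∑ j, ∑ k, s.psi k i j • (a i * x * a k * y * b j)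
      + ∑ i, ∑ j, ∑ k, s.phi i j k • (a i * x * b k * y * b j)
      + ∑ i, ∑ j, s.t i j • (a i * x * y * b j) + ∑ i, a i * x * c * y * b i := by
    simp only [h.b_mul_a, mul_add, add_mul, Finset.mul_sum, Finset.sum_mul, mul_smul_comm,
      smul_mul_assoc, mul_one, mul_ite, ite_mul, mul_zero, zero_mul, Finset.sum_add_distrib,
      Finset.sum_ite_eq, Finset.mem_univ, if_true]
  have h2 : ∑ i, ∑ j, a j * a i * x * b i * y * b j =
      ∑ i, ∑ j, ∑ k, s.phi i j k • (a i * x * b k * y * b j)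
      + ∑ j, ∑ i, s.mu j i • (x * b i * y * b j) := by
    rw [Finset.sum_comm]
    simp only [h.a_mul_a, add_mul, Finset.sum_mul, smul_mul_assoc, one_mul,
      Finset.sum_add_distrib]
    rw [Finset.sum_comm (f := fun i j => ∑ k, s.phi i j k • (a i * x * b k * y * b j))]
    congr 1
    refine Finset.sum_congr rfl fun i _ => ?_
    rw [Finset.sum_comm]
  have h3 : ∑ i, ∑ j, a j * x * a i * y * (b i * b j) =
      ∑ i, ∑ j, ∑ k, s.psi k i j • (a i * x * a k * y * b j)
      + ∑ i, ∑ j, s.lam i j • (a j * x * a i * y) := by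
    simp only [h.b_mul_b, mul_add, Finset.mul_sum, mul_smul_comm, mul_one,
      Finset.sum_add_distrib]
    rw [Finset.sum_comm]
    congr 1
    refine Finset.sum_congr rfl fun i _ => ?_
    rw [Finset.sum_comm]
  have hA := h.sum_defectA (x * y)
  have hA' := congrArg (· * y) (h.sum_defectA x)
  have hB' := congrArg (· * y) (h.sum_defectB x)
  simp only [Finset.sum_mul] at hA' hB'
  rw [Finset.sum_add_distrib, Finset.sum_sub_distrib, hA, hA', hB', obstruction_frameMap, h1, h2,
    h3]
  simp only [coboundary_apply, LinearMap.sub_apply, LinearMap.mulLeft_apply, LinearMap.sum_apply,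
    LinearMap.smul_apply, LinearMap.mulLeftRight_apply, add_mul, sub_mul, mul_sub,
    Finset.sum_mul, Finset.mul_sum, smul_mul_assoc, mul_smul_comm, mul_assoc]
  abel

/-- If `∑ aᵢ bⁱ + c` commutes with the `aⱼ` and the `bʲ`, then the product defined by
`x ↦ ∑ aᵢ x bⁱ + c x` is associative. -/
theorem MConstants.Holds.isAssociative (h : s.Holds a b c) (hA : ∀ j, s.defectA a b c j = 0)
    (hB : ∀ j, s.defectB a b c j = 0) : (coboundary (frameMap a b c)).IsAssociative := by
  rw [isAssociative_coboundary_iff]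
  have := isTwoCocycle_coboundary (X := X) (LinearMap.mulLeft ℂ (∑ i, ∑ k, s.mu i k • (b k * b i))
    - ∑ j, ∑ i, s.mu j i • LinearMap.mulLeftRight ℂ (b i, b j))
  convert this using 3 with x y
  simp [h.obstruction_eq, hA, hB]

end Relations

/-! ### Linear operators on matrices -/

section Contraction

variable {n : ℕ}

/-- Contraction of the left slot with a functional `f`: the linear map that sends the operator
`x ↦ u * x * w` to `f u • w`. -/
noncomputable def contractFst (f : Matrix (Fin n) (Fin n) ℂ →ₗ[ℂ] ℂ) :
    (Matrix (Fin n) (Fin n) ℂ →ₗ[ℂ] Matrix (Fin n) (Fin n) ℂ) →ₗ[ℂ] Matrix (Fin n) (Fin n) ℂ where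
  toFun T := Matrix.of fun l t => ∑ s, ∑ k, f (Matrix.single s k 1) * T (Matrix.single k l 1) s t
  map_add' T T' := by
    ext l t
    simp [mul_add, Finset.sum_add_distrib]
  map_smul' r T := by
    ext l t
    simp [Finset.mul_sum, mul_left_comm]

/-- Contraction of the right slot with a functional `g`: the linear map that sends the operator
`x ↦ u * x * w` to `g w • u`. -/
noncomputable def contractSnd (g : Matrix (Fin n) (Fin n) ℂ →ₗ[ℂ] ℂ) :
    (Matrix (Fin n) (Fin n) ℂ →ₗ[ℂ] Matrix (Fin n) (Fin n) ℂ) →ₗ[ℂ] Matrix (Fin n) (Fin n) ℂ where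
  toFun T := Matrix.of fun s k => ∑ l, ∑ t, g (Matrix.single l t 1) * T (Matrix.single k l 1) s t
  map_add' T T' := by
    ext l t
    simp [mul_add, Finset.sum_add_distrib]
  map_smul' r T := by
    ext l t
    simp [Finset.mul_sum, mul_left_comm]

theorem Matrix.functional_eq_sum (f : Matrix (Fin n) (Fin n) ℂ →ₗ[ℂ] ℂ)
    (u : Matrix (Fin n) (Fin n) ℂ) : f u = ∑ s, ∑ k, f (Matrix.single s k 1) * u s k := by
  conv_lhs => rw [Matrix.matrix_eq_sum_single u]
  simp only [map_sum]
  refine Finset.sum_congr rfl fun s _ => Finset.sum_congr rfl fun k _ => ?_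
  rw [← mul_one (u s k), ← smul_eq_mul, ← Matrix.smul_single, map_smul, smul_eq_mul, mul_comm]
  simp

theorem Matrix.mul_single_mul_apply (u w : Matrix (Fin n) (Fin n) ℂ) (k l s t : Fin n) :
    (u * Matrix.single k l (1 : ℂ) * w) s t = u s k * w l t := by
  rw [Matrix.mul_apply, Finset.sum_eq_single l]
  · simp
  · intro b _ hb
    simp [Matrix.mul_single_apply_of_ne, hb]
  · simp

@[simp]
theorem contractFst_mulLeftRight (f : Matrix (Fin n) (Fin n) ℂ →ₗ[ℂ] ℂ)
    (u w : Matrix (Fin n) (Fin n) ℂ) :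
    contractFst f (LinearMap.mulLeftRight ℂ (u, w)) = f u • w := by
  ext l t
  simp only [contractFst, LinearMap.coe_mk, AddHom.coe_mk, Matrix.of_apply,
    LinearMap.mulLeftRight_apply, Matrix.mul_single_mul_apply, Matrix.smul_apply, smul_eq_mul]
  rw [Matrix.functional_eq_sum f u, Finset.sum_mul]
  simp only [Finset.sum_mul, mul_assoc]

@[simp]
theorem contractSnd_mulLeftRight (g : Matrix (Fin n) (Fin n) ℂ →ₗ[ℂ] ℂ)
    (u w : Matrix (Fin n) (Fin n) ℂ) :
    contractSnd g (LinearMap.mulLeftRight ℂ (u, w)) = g w • u := by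
  ext s k
  simp only [contractSnd, LinearMap.coe_mk, AddHom.coe_mk, Matrix.of_apply,
    LinearMap.mulLeftRight_apply, Matrix.mul_single_mul_apply, Matrix.smul_apply, smul_eq_mul]
  rw [Matrix.functional_eq_sum g w, Finset.sum_mul]
  refine Finset.sum_congr rfl fun l _ => ?_
  rw [Finset.sum_mul]
  exact Finset.sum_congr rfl fun t _ => by ring

theorem sum_mulLeftRight_eq_zero {ι : Type*} [Fintype ι] {u w : ι → Matrix (Fin n) (Fin n) ℂ}
    (h : ∀ x, ∑ i, u i * x * w i = 0) :
    ∑ i, LinearMap.mulLeftRight ℂ (u i, w i) = 0 := by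
  ext1 x
  simpa using h x

/-- A linear relation between the operators `x ↦ uᵢ x wᵢ` may be contracted on the left. -/
theorem sum_functional_smul_right {ι : Type*} [Fintype ι] {u w : ι → Matrix (Fin n) (Fin n) ℂ}
    (h : ∀ x, ∑ i, u i * x * w i = 0) (f : Matrix (Fin n) (Fin n) ℂ →ₗ[ℂ] ℂ) :
    ∑ i, f (u i) • w i = 0 := by
  simpa using congrArg (contractFst f) (sum_mulLeftRight_eq_zero h)

/-- A linear relation between the operators `x ↦ uᵢ x wᵢ` may be contracted on the right. -/
theorem sum_functional_smul_left {ι : Type*} [Fintype ι] {u w : ι → Matrix (Fin n) (Fin n) ℂ}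
    (h : ∀ x, ∑ i, u i * x * w i = 0) (g : Matrix (Fin n) (Fin n) ℂ →ₗ[ℂ] ℂ) :
    ∑ i, g (w i) • u i = 0 := by
  simpa using congrArg (contractSnd g) (sum_mulLeftRight_eq_zero h)

/-- Every linear operator on matrices is a sum of operators `x ↦ u * x * w`. -/
theorem exists_eq_sum_mul_mul
    (T : Matrix (Fin n) (Fin n) ℂ →ₗ[ℂ] Matrix (Fin n) (Fin n) ℂ) :
    ∃ (p : ℕ) (u w : Fin p → Matrix (Fin n) (Fin n) ℂ), ∀ x, T x = ∑ i, u i * x * w i := by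
  -- `∑ₛ eₛₖ x eₗₛ` is the scalar matrix with the entry `xₖₗ`
  let e := (Fintype.equivFin (Fin n × Fin n × Fin n)).symm
  refine ⟨_, fun r => Matrix.single (e r).1 (e r).2.1 1,
    fun r => Matrix.single (e r).2.2 (e r).1 1 * T (Matrix.single (e r).2.1 (e r).2.2 1),
    fun x => ?_⟩
  rw [e.sum_comp (fun q : Fin n × Fin n × Fin n => Matrix.single q.1 q.2.1 1 * x *
    (Matrix.single q.2.2 q.1 1 * T (Matrix.single q.2.1 q.2.2 1)))]
  conv_lhs => rw [Matrix.matrix_eq_sum_single x]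
  simp only [map_sum, Fintype.sum_prod_type]
  have h1 : ∀ k l : Fin n, T (Matrix.single k l (x k l)) = ∑ s : Fin n, Matrix.single s k 1 * x *
      (Matrix.single l s 1 * T (Matrix.single k l 1)) := by
    intro k l
    simp only [← mul_assoc, ← Finset.sum_mul]
    have h2 : ∑ s : Fin n, Matrix.single s k 1 * x * Matrix.single l s 1
        = x k l • (1 : Matrix (Fin n) (Fin n) ℂ) := by
      ext i j
      simp [Matrix.sum_apply, Matrix.single_apply, Matrix.one_apply, ite_and]
    rw [h2, smul_mul_assoc, one_mul, ← map_smul]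
    simp
  simp only [h1]
  symm
  rw [Finset.sum_comm]
  exact Finset.sum_congr rfl fun k _ => Finset.sum_comm

/-- The element `∑ₖ eₖ₀ ⊗ e₀ₖ` commutes with matrices. -/
theorem sum_mul_single_mul [NeZero n] (g : Matrix (Fin n) (Fin n) ℂ →ₗ[ℂ] Matrix (Fin n) (Fin n) ℂ)
    (x : Matrix (Fin n) (Fin n) ℂ) :
    ∑ k, x * Matrix.single k 0 1 * g (Matrix.single 0 k 1) =
      ∑ k, Matrix.single k 0 1 * g (Matrix.single 0 k 1 * x) := by
  have h1 : ∀ k, x * Matrix.single k 0 1 = ∑ l, x l k • Matrix.single l (0 : Fin n) (1 : ℂ) := by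
    intro k
    ext i j
    simp [Matrix.sum_apply, Matrix.mul_apply, Matrix.single_apply, ite_and]
  have h2 : ∀ l, Matrix.single 0 l 1 * x = ∑ k, x l k • Matrix.single (0 : Fin n) k (1 : ℂ) := by
    intro k
    ext i j
    simp [Matrix.sum_apply, Matrix.mul_apply, Matrix.single_apply, ite_and]
  simp only [h1, h2, map_sum, map_smul, Finset.sum_mul, Finset.mul_sum, smul_mul_assoc,
    mul_smul_comm]
  exact Finset.sum_comm

theorem sum_single_mul_single [NeZero n] :
    ∑ k, Matrix.single k (0 : Fin n) (1 : ℂ) * Matrix.single 0 k 1 = 1 := by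
  ext i j
  simp [Matrix.sum_apply, Matrix.single_apply, Matrix.one_apply, ite_and]

/-- The second Hochschild cohomology of the matrix algebra vanishes. -/
theorem exists_eq_coboundary [NeZero n] (m : BilinearProduct (Matrix (Fin n) (Fin n) ℂ))
    (hm : IsTwoCocycle fun x y => m x y) : ∃ R, m = coboundary R := by
  refine ⟨∑ k, LinearMap.mulLeft ℂ (Matrix.single k 0 1) ∘ₗ m (Matrix.single 0 k 1), ?_⟩
  refine LinearMap.ext fun x => LinearMap.ext fun y => ?_
  have h0 := sum_mul_single_mul (m.flip y) x
  have h1 : ∑ k, Matrix.single k (0 : Fin n) (1 : ℂ) * (Matrix.single 0 k 1 * m x y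
      - m (Matrix.single 0 k 1 * x) y + m (Matrix.single 0 k 1) (x * y)
      - m (Matrix.single 0 k 1) x * y) = 0 :=
    Finset.sum_eq_zero fun k _ => by rw [hm (Matrix.single 0 k 1) x y, mul_zero]
  simp only [mul_add, mul_sub, Finset.sum_add_distrib, Finset.sum_sub_distrib, ← mul_assoc,
    ← Finset.sum_mul, sum_single_mul_single, one_mul] at h1
  simp only [LinearMap.flip_apply] at h0
  rw [← h0] at h1
  simp only [coboundary_apply, LinearMap.sum_apply, LinearMap.comp_apply,
    LinearMap.mulLeft_apply, Finset.mul_sum]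
  simp only [← mul_assoc]
  rw [← sub_eq_zero, ← h1]
  abel

/-- Two operators on matrices with the same coboundary differ by an inner derivation. -/
theorem exists_sub_eq_commutator [NeZero n]
    {R R' : Matrix (Fin n) (Fin n) ℂ →ₗ[ℂ] Matrix (Fin n) (Fin n) ℂ}
    (h : coboundary R = coboundary R') :
    ∃ d, ∀ x, R x - R' x = x * d - d * x := by
  have hD : ∀ x y, (R - R') (x * y) = (R - R') x * y + x * (R - R') y := by
    intro x y
    have := LinearMap.congr_fun (LinearMap.congr_fun h x) y
    simp only [coboundary_apply] at this
    simp only [LinearMap.sub_apply, sub_mul, mul_sub]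
    rw [← sub_eq_zero] at this ⊢
    rw [← neg_eq_zero, ← this]
    abel
  refine ⟨∑ k, Matrix.single k 0 1 * (R - R') (Matrix.single 0 k 1), fun x => ?_⟩
  have h0 := sum_mul_single_mul (R - R') x
  simp only [hD, mul_add, Finset.sum_add_distrib, ← mul_assoc, ← Finset.sum_mul,
    sum_single_mul_single, one_mul] at h0
  simp only [mul_assoc x, ← Finset.mul_sum] at h0
  rw [h0, ← LinearMap.sub_apply]
  abel

end Contraction

section Independence

variable {n p : ℕ}

theorem LinearIndependent.exists_functional {ι V : Type*} [AddCommGroup V] [Module ℂ V]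
    {v : ι → V} (hv : LinearIndependent ℂ v) (s : ι → ℂ) : ∃ f : V →ₗ[ℂ] ℂ, ∀ i, f (v i) = s i := by
  obtain ⟨f, hf⟩ := LinearMap.exists_extend ((Module.Basis.span hv).constr ℂ s)
  refine ⟨f, fun i => ?_⟩
  have := LinearMap.congr_fun hf (Module.Basis.span hv i)
  rwa [Module.Basis.constr_basis, LinearMap.comp_apply, Submodule.subtype_apply,
    Module.Basis.span_apply] at this

/-- A functional dual to `aᵢ` in an independent family `1, a₁, …, aₚ`. -/
theorem exists_dual_functional {V : Type*} [AddCommGroup V] [Module ℂ V] {e : V} {a : Fin p → V}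
    (h : LinearIndependent ℂ (Fin.cons e a : Fin (p + 1) → V)) :
    ∃ f : Fin p → V →ₗ[ℂ] ℂ, (∀ i, f i e = 0) ∧ ∀ i j, f i (a j) = if i = j then 1 else 0 := by
  choose f hf using fun i : Fin p =>
    h.exists_functional (Fin.cons 0 fun j => if i = j then 1 else 0 : Fin (p + 1) → ℂ)
  exact ⟨f, fun i => by simpa using hf i 0, fun i j => by simpa using hf i j.succ⟩

theorem eq_zero_of_sum_mul_mul_eq_zero {a b : Fin p → Matrix (Fin n) (Fin n) ℂ}
    (ha : LinearIndependent ℂ (Fin.cons 1 a : Fin (p + 1) → Matrix (Fin n) (Fin n) ℂ))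
    {e : Matrix (Fin n) (Fin n) ℂ} (h : ∀ x, ∑ i, a i * x * b i = x * e) (i : Fin p) : b i = 0 := by
  obtain ⟨f, hf1, hf⟩ := exists_dual_functional ha
  have := sum_functional_smul_right (u := (Fin.cons (-1) a : Fin (p + 1) → _))
    (w := (Fin.cons e b : Fin (p + 1) → _)) (fun x => by simp [Fin.sum_univ_succ, h x]) (f i)
  simpa [Fin.sum_univ_succ, hf1, hf] using this

theorem eq_zero_of_sum_mul_mul_eq_zero' {a b : Fin p → Matrix (Fin n) (Fin n) ℂ}
    (hb : LinearIndependent ℂ (Fin.cons 1 b : Fin (p + 1) → Matrix (Fin n) (Fin n) ℂ))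
    {e : Matrix (Fin n) (Fin n) ℂ} (h : ∀ x, ∑ i, a i * x * b i = e * x) (i : Fin p) : a i = 0 := by
  obtain ⟨f, hf1, hf⟩ := exists_dual_functional hb
  have := sum_functional_smul_left (w := (Fin.cons (-1) b : Fin (p + 1) → _))
    (u := (Fin.cons e a : Fin (p + 1) → _)) (fun x => by simp [Fin.sum_univ_succ, h x]) (f i)
  simpa [Fin.sum_univ_succ, hf1, hf] using this

end Independence

/-! ### Structure constants from associativity -/

section Closure

variable {n p : ℕ}

/-- Associativity, contracted on both sides with functionals that vanish at `1`. -/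
theorem contracted_associativity [NeZero n] {a b : Fin p → Matrix (Fin n) (Fin n) ℂ}
    {c : Matrix (Fin n) (Fin n) ℂ} (h : (coboundary (frameMap a b c)).IsAssociative)
    {f g : Matrix (Fin n) (Fin n) ℂ →ₗ[ℂ] ℂ} (hf : f 1 = 0) (hg : g 1 = 0) :
    ∃ r : ℂ, ∑ i, ∑ j, (f (a i) * g (b j)) • (b i * a j) =
      ∑ i, ∑ j, (f (a j * a i) * g (b j)) • b i + ∑ i, ∑ j, (f (a j) * g (b i * b j)) • a i
      + ∑ i, (f (a i) * g (b i)) • c + r • (1 : Matrix (Fin n) (Fin n) ℂ) := by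
  rw [isAssociative_coboundary_iff] at h
  obtain ⟨S, hS⟩ := exists_eq_coboundary
    ((LinearMap.mul ℂ _).compl₁₂ (frameMap a b c) (frameMap a b c)
      - (coboundary (frameMap a b c)).compr₂ (frameMap a b c)) h
  obtain ⟨q, u, w, hu⟩ := exists_eq_sum_mul_mul S
  have h0 : ∀ x y, obstruction (frameMap a b c) x y = ∑ k, u k * x * w k * y
      + ∑ k, x * u k * y * w k - ∑ k, u k * x * y * w k := by
    intro x y
    have : obstruction (frameMap a b c) x y = coboundary S x y :=
      LinearMap.congr_fun (LinearMap.congr_fun hS x) y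
    simpa only [coboundary_apply, hu, Finset.sum_mul, Finset.mul_sum, mul_assoc] using this
  have h1 : ∀ x, ∑ i, ∑ j, g (b j) • (a i * x * (b i * a j))
      - ∑ i, ∑ j, g (b j) • (a j * a i * x * b i)
      - ∑ i, ∑ j, g (b i * b j) • (a j * x * a i)
      + ∑ i, ∑ j, g (b i * b j) • (a j * a i * x)
      - ∑ i, g (b i) • (a i * x * c) + ∑ i, g (b i) • (c * a i * x)
      = ∑ k, g (w k) • (x * u k) - ∑ k, g (w k) • (u k * x) := by
    intro x
    have h2 : ∑ i, ∑ j, LinearMap.mulLeftRight ℂ (a i * x * (b i * a j), b j)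
        + ∑ i, LinearMap.mulLeftRight ℂ (a i * x * (b i * c), 1)
        - ∑ i, ∑ j, LinearMap.mulLeftRight ℂ (a j * a i * x * b i, b j)
        - ∑ i, ∑ j, LinearMap.mulLeftRight ℂ (a j * x * a i, b i * b j)
        + ∑ i, ∑ j, LinearMap.mulLeftRight ℂ (a j * a i * x, b i * b j)
        - ∑ i, LinearMap.mulLeftRight ℂ (a i * x * c, b i)
        - ∑ i, LinearMap.mulLeftRight ℂ (c * a i * x * b i, 1)
        + ∑ i, LinearMap.mulLeftRight ℂ (c * a i * x, b i)
        = ∑ k, LinearMap.mulLeftRight ℂ (u k * x * w k, 1)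
        + ∑ k, LinearMap.mulLeftRight ℂ (x * u k, w k)
        - ∑ k, LinearMap.mulLeftRight ℂ (u k * x, w k) := by
      refine LinearMap.ext fun y => ?_
      have := h0 x y
      rw [obstruction_frameMap] at this
      simpa only [LinearMap.add_apply, LinearMap.sub_apply, LinearMap.sum_apply,
        LinearMap.mulLeftRight_apply, mul_one] using this
    simpa only [map_add, map_sub, map_sum, contractSnd_mulLeftRight, hg, zero_smul,
      Finset.sum_const_zero, add_zero, zero_add, sub_zero] using congrArg (contractSnd g) h2
  have h3 : ∑ i, ∑ j, g (b j) • LinearMap.mulLeftRight ℂ (a i, b i * a j)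
      - ∑ i, ∑ j, g (b j) • LinearMap.mulLeftRight ℂ (a j * a i, b i)
      - ∑ i, ∑ j, g (b i * b j) • LinearMap.mulLeftRight ℂ (a j, a i)
      + ∑ i, ∑ j, g (b i * b j) • LinearMap.mulLeftRight ℂ (a j * a i, 1)
      - ∑ i, g (b i) • LinearMap.mulLeftRight ℂ (a i, c)
      + ∑ i, g (b i) • LinearMap.mulLeftRight ℂ (c * a i, 1)
      = ∑ k, g (w k) • LinearMap.mulLeftRight ℂ (1, u k)
      - ∑ k, g (w k) • LinearMap.mulLeftRight ℂ (u k, 1) := by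
    refine LinearMap.ext fun x => ?_
    simpa only [LinearMap.add_apply, LinearMap.sub_apply, LinearMap.sum_apply,
        LinearMap.smul_apply, LinearMap.mulLeftRight_apply, mul_one, one_mul] using h1 x
  have h4 := congrArg (contractFst f) h3
  simp only [map_add, map_sub, map_sum, map_smul, contractFst_mulLeftRight, hf, zero_smul,
    smul_zero, Finset.sum_const_zero, zero_sub, smul_smul, ← Finset.sum_smul] at h4
  refine ⟨-(∑ k, g (w k) * f (u k)) - ∑ i, ∑ j, g (b i * b j) * f (a j * a i)
    - ∑ i, g (b i) * f (c * a i), ?_⟩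
  simp only [sub_smul, neg_smul, ← h4, mul_comm (f _), ← Finset.sum_smul]
  abel

/-- The cocycles of the form `(x, y) ↦ G (x * y) + H x * y`. -/
theorem IsTwoCocycle.eq_mul {X : Type*} [Ring X] {G H : X → X}
    (h : IsTwoCocycle fun x y => G (x * y) + H x * y) (x : X) :
    G x = G 1 * x ∧ H x + G x = x * (H 1 + G 1) := by
  have h1 : ∀ x, H x + G x = x * (H 1 + G 1) := by
    intro x
    have := h x 1 1
    simp only [mul_one] at this
    rw [← sub_eq_zero, ← neg_eq_zero, ← this]
    noncomm_ring
  refine ⟨?_, h1 x⟩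
  have := h 1 1 x
  simp only [mul_one, one_mul] at this
  rw [← sub_eq_zero, ← this]
  noncomm_ring

theorem mem_span_of_functionals {V : Type*} [AddCommGroup V] [Module ℂ V] {W : Submodule ℂ V}
    {v : V} (h : ∀ f : V →ₗ[ℂ] ℂ, (∀ w ∈ W, f w = 0) → f v = 0) : v ∈ W := by
  by_contra hv
  obtain ⟨f, hf, hW⟩ := Submodule.exists_le_ker_of_notMem hv
  exact hf (h f fun w hw => hW hw)

/-- The expansion in an independent family `1, a₁, …, aₚ`, by dual functionals. -/
theorem exists_eq_sum_dual {V : Type*} [AddCommGroup V] [Module ℂ V] {e : V} {a : Fin p → V}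
    {f : Fin p → V →ₗ[ℂ] ℂ} (hf1 : ∀ i, f i e = 0)
    (hf : ∀ i j, f i (a j) = if i = j then 1 else 0) {v : V}
    (hv : v ∈ Submodule.span ℂ (Set.range (Fin.cons e a : Fin (p + 1) → V))) :
    ∃ r : ℂ, v = ∑ i, f i v • a i + r • e := by
  obtain ⟨s, rfl⟩ := (Submodule.mem_span_range_iff_exists_fun ℂ).1 hv
  refine ⟨s 0, ?_⟩
  simp [Fin.sum_univ_succ, hf1, hf, add_comm]

theorem exists_holds [NeZero n] {a b : Fin p → Matrix (Fin n) (Fin n) ℂ}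
    {c : Matrix (Fin n) (Fin n) ℂ}
    (ha : LinearIndependent ℂ (Fin.cons 1 a : Fin (p + 1) → Matrix (Fin n) (Fin n) ℂ))
    (hb : LinearIndependent ℂ (Fin.cons 1 b : Fin (p + 1) → Matrix (Fin n) (Fin n) ℂ))
    (h : (coboundary (frameMap a b c)).IsAssociative) :
    ∃ s : MConstants p, s.Holds a b c := by
  obtain ⟨f, hf1, hf⟩ := exists_dual_functional ha
  obtain ⟨g, hg1, hg⟩ := exists_dual_functional hb
  -- a functional that vanishes on `1` and the `aᵢ` vanishes on the products `aⱼ aᵢ`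
  have hA : ∀ i j, ∃ r : ℂ, a i * a j = ∑ k, f k (a i * a j) • a k
      + r • (1 : Matrix (Fin n) (Fin n) ℂ) := by
    intro i j
    refine exists_eq_sum_dual hf1 hf (mem_span_of_functionals fun f' hf' => ?_)
    have h1 : f' 1 = 0 := hf' _ (Submodule.subset_span ⟨0, rfl⟩)
    have ha' : ∀ k, f' (a k) = 0 := fun k => hf' _ (Submodule.subset_span ⟨k.succ, rfl⟩)
    obtain ⟨r, hr⟩ := contracted_associativity h h1 (hg1 i)
    have := congrArg (g j) hr.symm
    simpa [ha', hg, hg1] using this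
  have hB : ∀ i j, ∃ r : ℂ, b i * b j = ∑ k, g k (b i * b j) • b k
      + r • (1 : Matrix (Fin n) (Fin n) ℂ) := by
    intro i j
    refine exists_eq_sum_dual hg1 hg (mem_span_of_functionals fun g' hg' => ?_)
    have h1 : g' 1 = 0 := hg' _ (Submodule.subset_span ⟨0, rfl⟩)
    have hb' : ∀ k, g' (b k) = 0 := fun k => hg' _ (Submodule.subset_span ⟨k.succ, rfl⟩)
    obtain ⟨r, hr⟩ := contracted_associativity h (hf1 j) h1
    have := congrArg (f i) hr.symm
    simpa [hb', hf, hf1] using this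
  choose mu hmu using hA
  choose lam hlam using hB
  choose t ht using fun i j => contracted_associativity h (hf1 i) (hg1 j)
  refine ⟨⟨fun k i j => f k (a i * a j), mu, fun i j k => g k (b i * b j), lam, t⟩, hmu, hlam,
    fun i j => ?_⟩
  have := ht i j
  simp only [hf, hg] at this
  simp only [ite_mul, mul_ite, one_mul, mul_one, mul_zero, zero_mul, ite_smul, zero_smul,
    one_smul, Finset.sum_ite_eq, Finset.mem_univ, if_true] at this
  rw [this]
  abel

/-- If the product defined by `x ↦ ∑ aᵢ x bⁱ + c x` is associative, then `∑ aᵢ bⁱ + c` commutes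
with the `aⱼ` and the `bʲ`. -/
theorem MConstants.Holds.defect_eq_zero {s : MConstants p}
    {a b : Fin p → Matrix (Fin n) (Fin n) ℂ} {c : Matrix (Fin n) (Fin n) ℂ}
    (ha : LinearIndependent ℂ (Fin.cons 1 a : Fin (p + 1) → Matrix (Fin n) (Fin n) ℂ))
    (hb : LinearIndependent ℂ (Fin.cons 1 b : Fin (p + 1) → Matrix (Fin n) (Fin n) ℂ))
    (hs : s.Holds a b c) (h : (coboundary (frameMap a b c)).IsAssociative) :
    (∀ j, s.defectA a b c j = 0) ∧ ∀ j, s.defectB a b c j = 0 := by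
  rw [isAssociative_coboundary_iff] at h
  have hW := IsTwoCocycle.eq_mul (G := fun z => ∑ j, s.defectA a b c j * z * b j)
    (H := fun x => ∑ j, a j * x * s.defectB a b c j - ∑ j, s.defectA a b c j * x * b j) ?_
  · have hA : ∀ j, s.defectA a b c j = 0 :=
      eq_zero_of_sum_mul_mul_eq_zero' hb (e := ∑ j, s.defectA a b c j * 1 * b j)
        fun x => (hW x).1
    refine ⟨hA, eq_zero_of_sum_mul_mul_eq_zero ha (e := ∑ j, a j * s.defectB a b c j)
      fun x => ?_⟩
    simpa [hA] using (hW x).2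
  · intro x y z
    have h1 := h x y z
    have h2 := isTwoCocycle_coboundary
      (LinearMap.mulLeft ℂ (∑ i, ∑ k, s.mu i k • (b k * b i))
        - ∑ j, ∑ i, s.mu j i • LinearMap.mulLeftRight ℂ (b i, b j)) x y z
    simp only [hs.obstruction_eq, Finset.sum_add_distrib, Finset.sum_sub_distrib] at h1
    beta_reduce at h2
    generalize coboundary (LinearMap.mulLeft ℂ (∑ i, ∑ k, s.mu i k • (b k * b i))
        - ∑ j, ∑ i, s.mu j i • LinearMap.mulLeftRight ℂ (b i, b j)) = m at h1 h2
    refine Eq.trans ?_ (sub_eq_zero.2 (h1.trans h2.symm))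
    simp only [mul_add, mul_sub, add_mul, sub_mul, Finset.sum_mul]
    abel

end Closure

/-! ### Reduction to independent families -/

section Reduction

theorem coboundary_eq_of_sub_commutator {X : Type*} [Ring X] [Algebra ℂ X] {R R' : X →ₗ[ℂ] X}
    (d : X) (h : ∀ x, R x = R' x + (x * d - d * x)) : coboundary R = coboundary R' := by
  refine LinearMap.ext fun x => LinearMap.ext fun y => ?_
  simp only [coboundary_apply, h]
  noncomm_ring

theorem exists_eq_sum_succAbove {V : Type*} [AddCommGroup V] [Module ℂ V] {q : ℕ} {e : V}
    (he : e ≠ 0) {a : Fin (q + 1) → V}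
    (h : ¬ LinearIndependent ℂ (Fin.cons e a : Fin (q + 2) → V)) :
    ∃ (i : Fin (q + 1)) (r : ℂ) (s : Fin q → ℂ),
      a i = r • e + ∑ j, s j • a (i.succAbove j) := by
  obtain ⟨g, hg, k, hk⟩ := Fintype.not_linearIndependent_iff.1 h
  rw [Fin.sum_univ_succ] at hg
  simp only [Fin.cons_zero, Fin.cons_succ] at hg
  obtain ⟨i, hi⟩ : ∃ i : Fin (q + 1), g i.succ ≠ 0 := by
    by_contra! h0
    have : g 0 = 0 := by simpa [h0, he] using hg
    exact hk (Fin.cases this h0 k)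
  refine ⟨i, -(g i.succ)⁻¹ * g 0, fun j => -(g i.succ)⁻¹ * g (i.succAbove j).succ, ?_⟩
  rw [Fin.sum_univ_succAbove _ i] at hg
  have h1 : g i.succ • a i = -(g 0 • e + ∑ j, g (i.succAbove j).succ • a (i.succAbove j)) := by
    rw [eq_neg_iff_add_eq_zero, ← hg]
    abel
  rw [← inv_smul_smul₀ hi (a i), h1]
  simp only [mul_smul, neg_smul, ← Finset.smul_sum, Finset.sum_neg_distrib, smul_neg, smul_add]
  abel

/-- The operator `x ↦ ∑ aᵢ x bⁱ + c x` may be chosen with independent families `1, a₁, …, aₚ` and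
`1, b¹, …, bᵖ`, without changing its coboundary. -/
theorem exists_linearIndependent_frameMap {X : Type*} [Ring X] [Algebra ℂ X] [Nontrivial X]
    (p : ℕ) (a b : Fin p → X) (c : X) :
    ∃ (q : ℕ) (a' b' : Fin q → X) (c' : X),
      LinearIndependent ℂ (Fin.cons 1 a' : Fin (q + 1) → X) ∧
      LinearIndependent ℂ (Fin.cons 1 b' : Fin (q + 1) → X) ∧
      coboundary (frameMap a b c) = coboundary (frameMap a' b' c') := by
  induction p generalizing c with
  | zero =>
    refine ⟨0, a, b, c, ?_, ?_, rfl⟩ <;>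
    · rw [linearIndependent_finCons]
      exact ⟨linearIndependent_empty_type, by simp⟩
  | succ q ih =>
    by_cases ha : LinearIndependent ℂ (Fin.cons 1 a : Fin (q + 2) → X)
    · by_cases hb : LinearIndependent ℂ (Fin.cons 1 b : Fin (q + 2) → X)
      · exact ⟨_, a, b, c, ha, hb, rfl⟩
      · obtain ⟨i, r, s, hi⟩ := exists_eq_sum_succAbove one_ne_zero hb
        obtain ⟨q', a', b', c', ha', hb', h⟩ := ih (fun j => a (i.succAbove j) + s j • a i)
          (fun j => b (i.succAbove j)) (c + r • a i)
        refine ⟨q', a', b', c', ha', hb', h ▸ coboundary_eq_of_sub_commutator 0 fun x => ?_⟩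
        simp only [frameMap_apply]
        rw [Fin.sum_univ_succAbove _ i, hi]
        simp only [mul_add, add_mul, Finset.mul_sum, mul_smul_comm, smul_mul_assoc, mul_one,
          Finset.sum_add_distrib, mul_zero, zero_mul, sub_zero, add_zero]
        abel
    · obtain ⟨i, r, s, hi⟩ := exists_eq_sum_succAbove one_ne_zero ha
      obtain ⟨q', a', b', c', ha', hb', h⟩ := ih (fun j => a (i.succAbove j))
        (fun j => b (i.succAbove j) + s j • b i) (c + r • b i)
      refine ⟨q', a', b', c', ha', hb', h ▸ coboundary_eq_of_sub_commutator (r • b i) fun x => ?_⟩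
      simp only [frameMap_apply]
      rw [Fin.sum_univ_succAbove _ i, hi]
      simp only [mul_add, add_mul, Finset.sum_mul, mul_smul_comm, smul_mul_assoc, one_mul,
        Finset.sum_add_distrib]
      abel

theorem exists_eq_coboundary_frameMap {n : ℕ} [NeZero n]
    (m : BilinearProduct (Matrix (Fin n) (Fin n) ℂ)) (hm : IsTwoCocycle fun x y => m x y) :
    ∃ (p : ℕ) (a b : Fin p → Matrix (Fin n) (Fin n) ℂ) (c : Matrix (Fin n) (Fin n) ℂ),
      LinearIndependent ℂ (Fin.cons 1 a : Fin (p + 1) → Matrix (Fin n) (Fin n) ℂ) ∧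
      LinearIndependent ℂ (Fin.cons 1 b : Fin (p + 1) → Matrix (Fin n) (Fin n) ℂ) ∧
      m = coboundary (frameMap a b c) := by
  obtain ⟨R, rfl⟩ := exists_eq_coboundary m hm
  obtain ⟨p, u, w, h⟩ := exists_eq_sum_mul_mul R
  have : R = frameMap u w 0 := LinearMap.ext fun x => by simp [frameMap_apply, h]
  rw [this]
  exact exists_linearIndependent_frameMap p u w 0

/-- The associative products compatible with the product of `X`, in terms of cocycles. -/
theorem isCompatible_mul_iff {X : Type*} [Ring X] [Algebra ℂ X] {m : BilinearProduct X}
    (hm : m.IsAssociative) :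
    BilinearProduct.IsCompatible (LinearMap.mul ℂ X) m ↔ IsTwoCocycle fun x y => m x y := by
  constructor
  · intro h x y z
    have h1 := h 1 x y z
    simp only [LinearMap.add_apply, LinearMap.mul_apply', map_add, one_smul, hm x y z] at h1
    rw [← neg_eq_zero, ← sub_eq_zero.2 h1]
    simp only [mul_assoc]
    abel
  · intro h t x y z
    have h1 := h x y z
    simp only [LinearMap.add_apply, LinearMap.smul_apply, LinearMap.mul_apply', map_add, map_smul,
      smul_add, hm x y z, mul_assoc]
    rw [← sub_eq_zero, ← neg_eq_zero, ← smul_zero t, ← h1]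
    simp only [smul_add, smul_sub]
    abel

end Reduction

/-! ### Frames of weak `M`-structures -/

namespace WeakMStructure

section Frames

variable {L : Type u} [AddCommGroup L] [Module ℂ L] {S : WeakMStructure L}

/-- The conditions of `WeakMStructure.Frame`, for a given number of basis vectors. -/
structure IsFrame (S : WeakMStructure L) {p : ℕ} (A B : Fin p → L) (C : L) : Prop where
  linearIndependent_A : LinearIndependent ℂ (Fin.cons S.unit A : Fin (p + 1) → L)
  span_A : Submodule.span ℂ (Set.range (Fin.cons S.unit A : Fin (p + 1) → L)) = S.subA
  linearIndependent_B : LinearIndependent ℂ (Fin.cons S.unit B : Fin (p + 1) → L)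
  span_B : Submodule.span ℂ (Set.range (Fin.cons S.unit B : Fin (p + 1) → L)) = S.subB
  form_A_B : ∀ i j, S.form (A i) (B j) = if i = j then 1 else 0
  form_unit_C : S.form S.unit C = 1
  form_C_A : ∀ i, S.form C (A i) = 0
  form_C_B : ∀ i, S.form C (B i) = 0
  form_C_C : S.form C C = 0

theorem Frame.isFrame (F : S.Frame) : S.IsFrame F.A F.B F.C :=
  ⟨F.linearIndependent_A, F.span_A, F.linearIndependent_B, F.span_B, F.form_A_B, F.form_unit_C,
    F.form_C_A, F.form_C_B, F.form_C_C⟩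

/-- The frame formed by vectors with the required properties. -/
def IsFrame.toFrame {p : ℕ} {A B : Fin p → L} {C : L} (h : S.IsFrame A B C) : S.Frame :=
  ⟨p, A, B, C, h.1, h.2, h.3, h.4, h.5, h.6, h.7, h.8, h.9⟩

theorem form_eq_zero_of_mem_subA {v w : L} (hv : v ∈ S.subA) (hw : w ∈ S.subA) :
    S.form v w = 0 := S.form_subA ⟨v, hv⟩ ⟨w, hw⟩

theorem form_eq_zero_of_mem_subB {v w : L} (hv : v ∈ S.subB) (hw : w ∈ S.subB) :
    S.form v w = 0 := S.form_subB ⟨v, hv⟩ ⟨w, hw⟩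

namespace IsFrame

variable {p : ℕ} {A B : Fin p → L} {C : L}

theorem A_mem (h : S.IsFrame A B C) (i : Fin p) : A i ∈ S.subA := by
  rw [← h.span_A]
  exact Submodule.subset_span ⟨i.succ, rfl⟩

theorem B_mem (h : S.IsFrame A B C) (i : Fin p) : B i ∈ S.subB := by
  rw [← h.span_B]
  exact Submodule.subset_span ⟨i.succ, rfl⟩

/-- All values of the form on the vectors of a frame. -/
theorem form_table (h : S.IsFrame A B C) :
    (∀ i j, S.form (A i) (A j) = 0) ∧ (∀ i j, S.form (B i) (B j) = 0) ∧
    (∀ i j, S.form (B i) (A j) = if i = j then 1 else 0) ∧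
    (∀ i, S.form (A i) S.unit = 0) ∧ (∀ i, S.form (B i) S.unit = 0) ∧
    (∀ i, S.form S.unit (A i) = 0) ∧ (∀ i, S.form S.unit (B i) = 0) ∧
    (∀ i, S.form (A i) C = 0) ∧ (∀ i, S.form (B i) C = 0) ∧ S.form C S.unit = 1 ∧
    S.form S.unit S.unit = 0 := by
  refine ⟨fun i j => form_eq_zero_of_mem_subA (h.A_mem i) (h.A_mem j),
    fun i j => form_eq_zero_of_mem_subB (h.B_mem i) (h.B_mem j),
    fun i j => by rw [S.form_symm, h.form_A_B]; simp only [eq_comm],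
    fun i => form_eq_zero_of_mem_subA (h.A_mem i) S.unit_mem_subA,
    fun i => form_eq_zero_of_mem_subB (h.B_mem i) S.unit_mem_subB,
    fun i => form_eq_zero_of_mem_subA S.unit_mem_subA (h.A_mem i),
    fun i => form_eq_zero_of_mem_subB S.unit_mem_subB (h.B_mem i),
    fun i => by rw [S.form_symm, h.form_C_A], fun i => by rw [S.form_symm, h.form_C_B],
    by rw [S.form_symm, h.form_unit_C],
    form_eq_zero_of_mem_subA S.unit_mem_subA S.unit_mem_subA⟩

theorem exists_combination (h : S.IsFrame A B C) (v : L) :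
    ∃ (s t : Fin p → ℂ) (r q : ℂ), v = ∑ j, s j • A j + ∑ j, t j • B j + r • S.unit + q • C := by
  have hC : (Submodule.Quotient.mk C : L ⧸ (S.subA ⊔ S.subB)) ≠ 0 := by
    intro h0
    rw [Submodule.Quotient.mk_eq_zero] at h0
    obtain ⟨a, ha, b, hb, hab⟩ := Submodule.mem_sup.1 h0
    have := h.form_unit_C
    rw [← hab, map_add, form_eq_zero_of_mem_subA S.unit_mem_subA ha,
      form_eq_zero_of_mem_subB S.unit_mem_subB hb] at this
    simp at this
  obtain ⟨q, hq⟩ := (finrank_eq_one_iff_of_nonzero' _ hC).1 S.finrank_quot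
    (Submodule.Quotient.mk v)
  rw [← Submodule.Quotient.mk_smul, eq_comm, Submodule.Quotient.eq] at hq
  obtain ⟨a, ha, b, hb, hab⟩ := Submodule.mem_sup.1 hq
  rw [← h.span_A] at ha
  rw [← h.span_B] at hb
  obtain ⟨s, hs⟩ := (Submodule.mem_span_range_iff_exists_fun ℂ).1 ha
  obtain ⟨t, ht⟩ := (Submodule.mem_span_range_iff_exists_fun ℂ).1 hb
  refine ⟨fun j => s j.succ, fun j => t j.succ, s 0 + t 0, q, ?_⟩
  rw [← eq_sub_iff_add_eq.1 hab, ← hs, ← ht]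
  simp only [Fin.sum_univ_succ, Fin.cons_zero, Fin.cons_succ, add_smul]
  abel

/-- The coordinates of a vector in a frame are the values of the form on the frame. -/
theorem expansion (h : S.IsFrame A B C) (v : L) :
    v = ∑ j, S.form v (B j) • A j + ∑ j, S.form v (A j) • B j + S.form v C • S.unit
      + S.form v S.unit • C := by
  obtain ⟨s, t, r, q, rfl⟩ := h.exists_combination v
  obtain ⟨h1, h2, h3, h4, h5, h6, h7, h8, h9, h10, h11⟩ := h.form_table
  simp [h.form_A_B, h.form_unit_C, h.form_C_A, h.form_C_B, h.form_C_C, h1, h2, h3, h4, h5, h6, h7,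
    h8, h9, h10, h11]

theorem form_eq_sum (h : S.IsFrame A B C) (v w : L) :
    S.form v w = ∑ j, S.form v (B j) * S.form (A j) w + ∑ j, S.form v (A j) * S.form (B j) w
      + S.form v C * S.form S.unit w + S.form v S.unit * S.form C w := by
  conv_lhs => rw [h.expansion v]
  simp

theorem mem_subA_iff (h : S.IsFrame A B C) (v : L) :
    v ∈ S.subA ↔ ∀ a ∈ S.subA, S.form v a = 0 := by
  refine ⟨fun hv a ha => form_eq_zero_of_mem_subA hv ha, fun hv => ?_⟩
  rw [h.expansion v]
  simp only [hv _ (h.A_mem _), hv _ S.unit_mem_subA, zero_smul, Finset.sum_const_zero, add_zero]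
  exact add_mem (sum_mem fun i _ => Submodule.smul_mem _ _ (h.A_mem i))
    (Submodule.smul_mem _ _ S.unit_mem_subA)

theorem mem_subB_iff (h : S.IsFrame A B C) (v : L) :
    v ∈ S.subB ↔ ∀ b ∈ S.subB, S.form v b = 0 := by
  refine ⟨fun hv a ha => form_eq_zero_of_mem_subB hv ha, fun hv => ?_⟩
  rw [h.expansion v]
  simp only [hv _ (h.B_mem _), hv _ S.unit_mem_subB, zero_smul, Finset.sum_const_zero, add_zero,
    zero_add]
  exact add_mem (sum_mem fun i _ => Submodule.smul_mem _ _ (h.B_mem i))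
    (Submodule.smul_mem _ _ S.unit_mem_subB)

/-- The expansion of a vector of `𝒜`. -/
theorem expansion_A (h : S.IsFrame A B C) {v : L} (hv : v ∈ S.subA) :
    v = ∑ j, S.form v (B j) • A j + S.form v C • S.unit := by
  conv_lhs => rw [h.expansion v]
  simp [form_eq_zero_of_mem_subA hv (h.A_mem _), form_eq_zero_of_mem_subA hv S.unit_mem_subA]

theorem expansion_B (h : S.IsFrame A B C) {v : L} (hv : v ∈ S.subB) :
    v = ∑ j, S.form v (A j) • B j + S.form v C • S.unit := by
  conv_lhs => rw [h.expansion v]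
  simp [form_eq_zero_of_mem_subB hv (h.B_mem _), form_eq_zero_of_mem_subB hv S.unit_mem_subB]

/-- The tensor `∑ Aᵢ ⊗ Bⁱ` in two frames. Bilinear maps into a vector space stand for linear maps
on the tensor square. -/
theorem sum_bilin {q : ℕ} {A' B' : Fin q → L} {C' : L} (h : S.IsFrame A B C)
    (h' : S.IsFrame A' B' C') {Y : Type*} [AddCommGroup Y] [Module ℂ Y] (β : L →ₗ[ℂ] L →ₗ[ℂ] Y) :
    ∑ i, β (A' i) (B' i) = ∑ i, β (A i) (B i) - ∑ i, S.form C' (B i) • β (A i) S.unit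
      - ∑ i, S.form C' (A i) • β S.unit (B i) - S.form C' C • β S.unit S.unit := by
  obtain ⟨h1, h2, h3, h4, h5, h6, h7, h8, h9, h10, h11⟩ := h.form_table
  -- the values of the form on the first frame, expanded in the second frame
  have hBA : ∀ i j, ∑ k, S.form (A' k) (B i) * S.form (B' k) (A j) = if i = j then 1 else 0 := by
    intro i j
    have := h'.form_eq_sum (B i) (A j)
    simpa [h3, h5, h6, form_eq_zero_of_mem_subB (h.B_mem i) (h'.B_mem _), S.form_symm (B i) (A' _)]
      using this.symm
  have hBC : ∀ i, ∑ k, S.form (A' k) (B i) * S.form (B' k) C = - S.form C' (B i) := by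
    intro i
    have := h'.form_eq_sum (B i) C
    simp only [h5, h9, form_eq_zero_of_mem_subB (h.B_mem i) (h'.B_mem _), S.form_symm (B i) (A' _),
      S.form_symm (B i) C', h.form_unit_C, zero_mul, Finset.sum_const_zero] at this
    linear_combination -this
  have hAC : ∀ i, ∑ k, S.form (A' k) C * S.form (B' k) (A i) = - S.form C' (A i) := by
    intro i
    have := h'.form_eq_sum C (A i)
    simp only [h6, h10, form_eq_zero_of_mem_subA (h'.A_mem _) (h.A_mem i), S.form_symm C (A' _),
      h.form_C_A, mul_zero, Finset.sum_const_zero] at this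
    linear_combination -this
  have hCC : ∑ k, S.form (A' k) C * S.form (B' k) C = - S.form C' C := by
    have := h'.form_eq_sum C C
    simp only [h10, h.form_C_C, h.form_unit_C, S.form_symm C (A' _), S.form_symm C (B' _),
      S.form_symm C C', mul_comm (S.form (B' _) C)] at this
    linear_combination -this / 2
  have hexp : ∀ k, β (A' k) (B' k) =
      ∑ i, ∑ j, (S.form (A' k) (B i) * S.form (B' k) (A j)) • β (A i) (B j)
      + ∑ i, (S.form (A' k) (B i) * S.form (B' k) C) • β (A i) S.unit
      + ∑ i, (S.form (A' k) C * S.form (B' k) (A i)) • β S.unit (B i)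
      + (S.form (A' k) C * S.form (B' k) C) • β S.unit S.unit := by
    intro k
    conv_lhs => rw [h.expansion_A (h'.A_mem k), h.expansion_B (h'.B_mem k)]
    simp only [map_add, map_sum, map_smul, LinearMap.add_apply, LinearMap.sum_apply,
      LinearMap.smul_apply, smul_add, Finset.smul_sum, smul_smul, Finset.sum_add_distrib]
    rw [Finset.sum_comm]
    simp only [mul_comm]
    abel
  simp only [hexp, Finset.sum_add_distrib]
  rw [Finset.sum_comm, Finset.sum_congr rfl fun i _ => Finset.sum_comm]
  rw [Finset.sum_comm (f := fun k i => (S.form (A' k) (B i) * S.form (B' k) C) • β (A i) S.unit),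
    Finset.sum_comm (f := fun k i => (S.form (A' k) C * S.form (B' k) (A i)) • β S.unit (B i))]
  simp only [← Finset.sum_smul, hBA, hBC, hAC, hCC]
  simp [sub_eq_add_neg]

/-- The vector `C` of a second frame. -/
theorem expansion_C {q : ℕ} {A' B' : Fin q → L} {C' : L} (h : S.IsFrame A B C)
    (h' : S.IsFrame A' B' C') :
    C' = ∑ j, S.form C' (B j) • A j + ∑ j, S.form C' (A j) • B j + S.form C' C • S.unit + C := by
  conv_lhs => rw [h.expansion C', h'.form_table.2.2.2.2.2.2.2.2.2.1, one_smul]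

/-- `∑ Aᵢ Bⁱ + C` does not depend on the frame. -/
theorem sum_mul_add_eq {q : ℕ} {A' B' : Fin q → L} {C' : L} (h : S.IsFrame A B C)
    (h' : S.IsFrame A' B' C') :
    ∑ i, S.toU (A' i) * S.toU (B' i) + S.toU C' = ∑ i, S.toU (A i) * S.toU (B i) + S.toU C := by
  have h1 := h.sum_bilin h' ((LinearMap.mul ℂ S.U).compl₁₂ S.toU S.toU)
  simp only [LinearMap.compl₁₂_apply, LinearMap.mul_apply', S.toU_unit, mul_one, one_mul] at h1
  have h2 := congrArg S.toU (h.expansion_C h')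
  simp only [map_add, map_sum, map_smul, S.toU_unit] at h2
  rw [h1, h2]
  abel

/-- The product defined by a frame does not depend on the frame. -/
theorem coboundary_eq {q : ℕ} {A' B' : Fin q → L} {C' : L} (h : S.IsFrame A B C)
    (h' : S.IsFrame A' B' C') {X : Type*} [Ring X] [Algebra ℂ X] (r : L →ₗ[ℂ] X)
    (hr : r S.unit = 1) :
    coboundary (frameMap (fun i => r (A' i)) (fun i => r (B' i)) (r C')) =
      coboundary (frameMap (fun i => r (A i)) (fun i => r (B i)) (r C)) := by
  refine coboundary_eq_of_sub_commutator (-∑ i, S.form C' (A i) • r (B i)) fun x => ?_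
  have h1 := h.sum_bilin h' ((LinearMap.mul ℂ X).compl₁₂ (LinearMap.mulRight ℂ x ∘ₗ r) r)
  simp only [LinearMap.compl₁₂_apply, LinearMap.mul_apply', LinearMap.comp_apply,
    LinearMap.mulRight_apply, hr, mul_one, one_mul] at h1
  have h2 := congrArg r (h.expansion_C h')
  simp only [map_add, map_sum, map_smul, hr] at h2
  rw [frameMap_apply, frameMap_apply, h1, h2]
  simp only [add_mul, mul_neg, neg_mul, Finset.sum_mul, Finset.mul_sum, smul_mul_assoc, one_mul,
    mul_smul_comm]
  abel

end IsFrame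

theorem Frame.product_eq (F : S.Frame) {n : ℕ} (ρ : S.U →ₐ[ℂ] Matrix (Fin n) (Fin n) ℂ)
    (x y : Matrix (Fin n) (Fin n) ℂ) :
    F.product ρ x y = coboundary (frameMap (fun i => ρ (S.toU (F.A i)))
      (fun i => ρ (S.toU (F.B i))) (ρ (S.toU F.C))) x y := by
  simp only [Frame.product, coboundary_apply, frameMap_apply, Finset.sum_add_distrib,
    Finset.sum_sub_distrib, mul_add, add_mul, Finset.mul_sum, Finset.sum_mul, mul_assoc]
  abel

end Frames

end WeakMStructure

/-! ### Existence of frames and structure constants in a frame -/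

namespace WeakMStructure

section Existence

variable {L : Type u} [AddCommGroup L] [Module ℂ L] {S : WeakMStructure L}

/-- Dual bases of `𝒜` and `ℬ` are completed to a frame by a vector `C`. -/
theorem exists_isFrame_of_dual {p : ℕ} {A B : Fin p → L}
    (hA : LinearIndependent ℂ (Fin.cons S.unit A : Fin (p + 1) → L))
    (hsA : Submodule.span ℂ (Set.range (Fin.cons S.unit A : Fin (p + 1) → L)) = S.subA)
    (hB : LinearIndependent ℂ (Fin.cons S.unit B : Fin (p + 1) → L))
    (hsB : Submodule.span ℂ (Set.range (Fin.cons S.unit B : Fin (p + 1) → L)) = S.subB)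
    (hAB : ∀ i j, S.form (A i) (B j) = if i = j then 1 else 0) :
    ∃ C, S.IsFrame A B C := by
  have hmA : ∀ i, A i ∈ S.subA := fun i => hsA ▸ Submodule.subset_span ⟨i.succ, rfl⟩
  have hmB : ∀ i, B i ∈ S.subB := fun i => hsB ▸ Submodule.subset_span ⟨i.succ, rfl⟩
  have hBA : ∀ i j, S.form (B i) (A j) = if i = j then 1 else 0 := fun i j => by
    rw [S.form_symm, hAB]
    simp only [eq_comm]
  have h1 : S.unit ≠ 0 := hA.ne_zero 0
  have hAA := fun i j => form_eq_zero_of_mem_subA (hmA i) (hmA j)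
  have hBB := fun i j => form_eq_zero_of_mem_subB (hmB i) (hmB j)
  have hA1 := fun i => form_eq_zero_of_mem_subA S.unit_mem_subA (hmA i)
  have hB1 := fun i => form_eq_zero_of_mem_subB S.unit_mem_subB (hmB i)
  have h11 := form_eq_zero_of_mem_subA S.unit_mem_subA S.unit_mem_subA
  obtain ⟨v, hv⟩ : ∃ v, S.form S.unit v ≠ 0 := by
    by_contra! h0
    exact h1 (S.form_nondegenerate _ h0)
  -- Gram-Schmidt orthogonalization, followed by a shift by a multiple of the isotropic vector `1`
  obtain ⟨w, hw1, hwA, hwB⟩ : ∃ w, S.form S.unit w = 1 ∧ (∀ i, S.form w (A i) = 0) ∧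
      ∀ i, S.form w (B i) = 0 := by
    refine ⟨(S.form S.unit v)⁻¹ • (v - ∑ j, S.form v (B j) • A j - ∑ j, S.form v (A j) • B j),
      ?_, fun i => ?_, fun i => ?_⟩
    · simp [hA1, hB1, hv]
    · simp [hAA, hBA]
    · simp [hBB, hAB]
  refine ⟨w - (S.form w w / 2) • S.unit, hA, hsA, hB, hsB, hAB, ?_, fun i => ?_, fun i => ?_, ?_⟩
  · simp [hw1, h11]
  · simp [hwA, hA1]
  · simp [hwB, hB1]
  · simp only [map_sub, map_smul, LinearMap.sub_apply, LinearMap.smul_apply, h11, hw1,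
      S.form_symm w S.unit, smul_eq_mul]
    ring

variable [FiniteDimensional ℂ L]

theorem finrank_subA_eq (S : WeakMStructure L) :
    Module.finrank ℂ S.subA = Module.finrank ℂ S.subB ∧
      ∀ v : L, (∀ b ∈ S.subB, S.form b v = 0) → v ∈ S.subB := by
  have hnd : LinearMap.BilinForm.Nondegenerate S.form :=
    ⟨S.form_nondegenerate, fun v hv => S.form_nondegenerate v fun w => by rw [S.form_symm, hv]⟩
  have hA := LinearMap.BilinForm.finrank_orthogonal hnd S.subA
  have hB := LinearMap.BilinForm.finrank_orthogonal hnd S.subB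
  have hA' : S.subA ≤ LinearMap.BilinForm.orthogonal S.form S.subA := fun v hv w hw =>
    form_eq_zero_of_mem_subA hw hv
  have hB' : S.subB ≤ LinearMap.BilinForm.orthogonal S.form S.subB := fun v hv w hw =>
    form_eq_zero_of_mem_subB hw hv
  have hdA := Submodule.finrank_mono hA'
  have hdB := Submodule.finrank_mono hB'
  have h1 := Submodule.finrank_sup_add_finrank_inf_eq S.subA S.subB
  have h2 := Submodule.finrank_quotient_add_finrank (S.subA ⊔ S.subB)
  rw [S.finrank_inf] at h1
  rw [S.finrank_quot] at h2
  refine ⟨by omega, fun v hv => ?_⟩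
  rw [Submodule.eq_of_le_of_finrank_eq hB' (by omega)]
  exact hv

/-- Every weak `M`-structure has a frame. -/
theorem exists_isFrame (S : WeakMStructure L) :
    ∃ (p : ℕ) (A B : Fin p → L) (C : L), S.IsFrame A B C := by
  obtain ⟨hfin, horth⟩ := S.finrank_subA_eq
  have hunit : S.unit ≠ 0 := by
    intro h0
    have := S.finrank_inf
    rw [S.inf_eq_span, h0, Submodule.span_zero_singleton, finrank_bot] at this
    exact zero_ne_one this
  obtain ⟨Q, hQ⟩ := Submodule.exists_isCompl (Submodule.span ℂ {S.unit})
  -- a complement of `1` in `𝒜`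
  let W := Q ⊓ S.subA
  have hWsup : Submodule.span ℂ {S.unit} ⊔ W = S.subA := by
    rw [← sup_inf_assoc_of_le Q ((Submodule.span_singleton_le_iff_mem _ _).2 S.unit_mem_subA),
      hQ.sup_eq_top, top_inf_eq]
  let p := Module.finrank ℂ W
  let A : Fin p → L := fun i => Module.finBasis ℂ W i
  have hspan : Submodule.span ℂ (Set.range A) = W := by
    have h1 : Set.range A = W.subtype '' Set.range (Module.finBasis ℂ W) := by
      rw [← Set.range_comp]
      rfl
    rw [h1, ← Submodule.map_span, Module.Basis.span_eq, Submodule.map_top,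
      Submodule.range_subtype]
  have hAW : ∀ i, A i ∈ S.subA := fun i => (Module.finBasis ℂ W i).2.2
  have hA : LinearIndependent ℂ (Fin.cons S.unit A : Fin (p + 1) → L) := by
    rw [linearIndependent_finCons, hspan]
    refine ⟨(Module.finBasis ℂ W).linearIndependent.map' W.subtype W.ker_subtype, fun hmem => ?_⟩
    exact hunit (Submodule.disjoint_def.1 hQ.disjoint _ (Submodule.mem_span_singleton_self _)
      hmem.1)
  have hsA : Submodule.span ℂ (Set.range (Fin.cons S.unit A : Fin (p + 1) → L)) = S.subA := by
    rw [Fin.range_cons, Submodule.span_insert, hspan, hWsup]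
  -- the vectors `Aᵢ` are independent modulo `ℬ`
  have hmk : LinearIndependent ℂ (S.subB.mkQ ∘ A) := by
    refine (linearIndependent_finCons.1 hA).1.map ?_
    rw [Submodule.ker_mkQ, hspan, Submodule.disjoint_def]
    intro v hvW hvB
    have hv : v ∈ S.subA ⊓ S.subB := ⟨hvW.2, hvB⟩
    rw [S.inf_eq_span] at hv
    exact Submodule.disjoint_def.1 hQ.disjoint _ hv hvW.1
  have hinj : Function.Injective S.form := by
    rw [injective_iff_map_eq_zero]
    exact fun v hv => S.form_nondegenerate v fun w => by rw [hv, LinearMap.zero_apply]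
  have hsurj : Function.Surjective S.form :=
    (LinearMap.injective_iff_surjective_of_finrank_eq_finrank
      Subspace.dual_finrank_eq.symm).1 hinj
  have hB : ∀ j : Fin p, ∃ w ∈ S.subB, ∀ i, S.form (A i) w = if i = j then 1 else 0 := by
    intro j
    obtain ⟨f, hf⟩ := hmk.exists_functional fun i => if i = j then 1 else 0
    obtain ⟨w, hw⟩ := hsurj (f ∘ₗ S.subB.mkQ)
    refine ⟨w, horth w fun b hb => ?_, fun i => ?_⟩
    · rw [S.form_symm, hw, LinearMap.comp_apply, Submodule.mkQ_apply,
        (Submodule.Quotient.mk_eq_zero _).2 hb, map_zero]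
    · rw [S.form_symm, hw]
      exact hf i
  choose B hBmem hAB using hB
  have hAB' : ∀ i j, S.form (A i) (B j) = if i = j then 1 else 0 := fun i j => hAB j i
  have hBli : LinearIndependent ℂ (Fin.cons S.unit B : Fin (p + 1) → L) := by
    rw [Fintype.linearIndependent_iff]
    intro g hg
    simp only [Fin.sum_univ_succ, Fin.cons_zero, Fin.cons_succ] at hg
    have h1 : ∀ i, g (Fin.succ i) = 0 := by
      intro i
      have := congrArg (S.form (A i)) hg
      simpa [hAB', form_eq_zero_of_mem_subA (hAW i) S.unit_mem_subA] using this
    have h0 : g 0 = 0 := by simpa [h1, hunit] using hg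
    exact Fin.cases h0 h1
  have hsB : Submodule.span ℂ (Set.range (Fin.cons S.unit B : Fin (p + 1) → L)) = S.subB := by
    refine Submodule.eq_of_le_of_finrank_eq ?_ ?_
    · rw [Fin.range_cons, Submodule.span_le, Set.insert_subset_iff]
      exact ⟨S.unit_mem_subB, Set.range_subset_iff.2 hBmem⟩
    · rw [finrank_span_eq_card hBli, ← hfin, ← hsA, finrank_span_eq_card hA]
  obtain ⟨C, hC⟩ := exists_isFrame_of_dual hA hsA hBli hsB hAB'
  exact ⟨p, A, B, C, hC⟩

end Existence

section StructureConstants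

variable {L : Type u} [AddCommGroup L] [Module ℂ L] {S : WeakMStructure L}

theorem lact_coe_subA (b : S.subB) (a : S.subA) : S.lact b (a : L) = S.ract (b : L) a := by
  have h1 := S.act_comm b S.unit a
  have h2 : S.ract S.unit a = a := by
    have := S.ract_eq_mulA ⟨S.unit, S.unit_mem_subA⟩ a
    rwa [S.unit_mulA] at this
  have h3 : S.lact b S.unit = b := by
    have := S.lact_eq_mulB b ⟨S.unit, S.unit_mem_subB⟩
    rwa [S.mulB_unit] at this
  rw [h2, h3] at h1
  exact h1.symm

/-- The structure constants of a weak `M`-structure in a frame. -/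
theorem IsFrame.exists_holds {p : ℕ} {A B : Fin p → L} {C : L} (h : S.IsFrame A B C) :
    ∃ s : MConstants p,
      s.Holds (fun i => S.toU (A i)) (fun i => S.toU (B i)) (S.toU C) := by
  let A' : Fin p → S.subA := fun i => ⟨A i, h.A_mem i⟩
  let B' : Fin p → S.subB := fun i => ⟨B i, h.B_mem i⟩
  refine ⟨⟨fun k i j => S.form (S.mulA (A' i) (A' j)) (B k),
    fun i j => S.form (S.mulA (A' i) (A' j)) C,
    fun i j k => S.form (S.mulB (B' i) (B' j)) (A k),
    fun i j => S.form (S.mulB (B' i) (B' j)) C,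
    fun i j => S.form (S.lact (B' i) (A j)) C⟩, ?_, ?_, ?_⟩
  · intro i j
    have h1 := S.toU_ract (A i) (A' j)
    rw [show S.ract (A i) (A' j) = S.mulA (A' i) (A' j) from S.ract_eq_mulA (A' i) (A' j)] at h1
    rw [← h1, h.expansion_A (S.mulA (A' i) (A' j)).2]
    simp only [map_add, map_sum, map_smul, S.toU_unit]
  · intro i j
    have h1 := S.toU_lact (B' i) (B j)
    rw [show S.lact (B' i) (B j) = S.mulB (B' i) (B' j) from S.lact_eq_mulB (B' i) (B' j)] at h1
    rw [← h1, h.expansion_B (S.mulB (B' i) (B' j)).2]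
    simp only [map_add, map_sum, map_smul, S.toU_unit]
  · intro i j
    have h1 := congrArg S.toU (h.expansion (S.lact (B' i) (A j)))
    rw [S.toU_lact] at h1
    have hA : ∀ k, S.form (S.lact (B' i) (A j)) (A k) = S.form (S.mulA (A' j) (A' k)) (B i) := by
      intro k
      rw [show S.lact (B' i) (A j) = S.ract (B i) (A' j) from lact_coe_subA (B' i) (A' j),
        S.form_symm _ (B i)]
      exact (S.form_mulA (B i) (A' j) (A' k)).symm
    have hB : ∀ k, S.form (S.lact (B' i) (A j)) (B k) = S.form (S.mulB (B' k) (B' i)) (A j) := by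
      intro k
      rw [S.form_symm, S.form_mulB]
    have hu : S.form (S.lact (B' i) (A j)) S.unit = if i = j then 1 else 0 := by
      have h2 := S.form_mulA (B i) (A' j) ⟨S.unit, S.unit_mem_subA⟩
      rw [show S.lact (B' i) (A j) = S.ract (B i) (A' j) from lact_coe_subA (B' i) (A' j), ← h2,
        S.mulA_unit, h.form_table.2.2.1]
    simp only [map_add, map_sum, map_smul, S.toU_unit, hA, hB, hu, ite_smul, one_smul,
      zero_smul, apply_ite S.toU, map_zero] at h1
    exact h1

theorem _root_.MConstants.Holds.map {X Y : Type*} [Ring X] [Algebra ℂ X] [Ring Y] [Algebra ℂ Y]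
    {p : ℕ} {s : MConstants p} {a b : Fin p → X} {c : X} (h : s.Holds a b c) (f : X →ₐ[ℂ] Y) :
    s.Holds (fun i => f (a i)) (fun i => f (b i)) (f c) where
  a_mul_a i j := by
    rw [← map_mul, h.a_mul_a]
    simp only [map_add, map_sum, map_smul, map_one]
  b_mul_b i j := by
    rw [← map_mul, h.b_mul_b]
    simp only [map_add, map_sum, map_smul, map_one]
  b_mul_a i j := by
    rw [← map_mul, h.b_mul_a]
    simp only [map_add, map_sum, map_smul, map_one, apply_ite f, map_zero]

/-- Centrality of `∑ Aᵢ Bⁱ + C` yields the associativity of the product. -/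
theorem IsFrame.isAssociative {p : ℕ} {A B : Fin p → L} {C : L} (h : S.IsFrame A B C)
    (hS : S.IsMStructure) {X : Type*} [Ring X] [Algebra ℂ X] (ρ : S.U →ₐ[ℂ] X) :
    (coboundary (frameMap (fun i => ρ (S.toU (A i))) (fun i => ρ (S.toU (B i)))
      (ρ (S.toU C)))).IsAssociative := by
  obtain ⟨s, hs⟩ := h.exists_holds
  have hρ := hs.map ρ
  have hK : ∀ v, (∑ i, ρ (S.toU (A i)) * ρ (S.toU (B i)) + ρ (S.toU C)) * ρ v =
      ρ v * (∑ i, ρ (S.toU (A i)) * ρ (S.toU (B i)) + ρ (S.toU C)) := by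
    intro v
    have := congrArg ρ (Subalgebra.mem_center_iff.1 (hS h.toFrame) v)
    simp only [Frame.K, map_mul, map_add, map_sum] at this
    exact this.symm
  refine hρ.isAssociative (fun j => ?_) fun j => ?_
  · rw [← hρ.commutator_a, hK, sub_self]
  · rw [← hρ.commutator_b, hK, sub_self]

end StructureConstants

end WeakMStructure

/-! ### The `M`-structure with given structure constants -/

namespace MConstants

variable {p : ℕ} (s : MConstants p)

/-- The coefficient of `aₗ` in `c aⱼ`, which is also that of `bʲ` in `bˡ c`. -/
noncomputable def u (l j : Fin p) : ℂ := -(∑ i, ∑ k, s.psi k i j * s.phi l i k) - s.t l j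

/-- The coefficient of `1` in `c aⱼ`. -/
noncomputable def w (j : Fin p) : ℂ := -∑ i, ∑ k, s.psi k i j * s.mu i k

/-- The coefficient of `1` in `bˡ c`. -/
noncomputable def w' (l : Fin p) : ℂ := -∑ i, ∑ k, s.phi l i k * s.lam k i

variable {X : Type*} [Ring X] [Algebra ℂ X] {s} {a b : Fin p → X} {c : X}

theorem Holds.defectA_eq (h : s.Holds a b c) (j : Fin p) :
    s.defectA a b c j = c * a j
      - (∑ k, s.u k j • a k + ∑ k, s.mu j k • b k + s.w j • (1 : X)) := by
  have h1 : ∑ i, ∑ k, ∑ l, (s.psi k i j * s.phi l i k) • a l =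
      ∑ l, ∑ i, ∑ k, (s.psi k i j * s.phi l i k) • a l := by
    rw [Finset.sum_congr rfl fun i _ => Finset.sum_comm, Finset.sum_comm]
  simp only [defectA, h.a_mul_a, u, w, smul_add, Finset.smul_sum, smul_smul, sub_smul, neg_smul,
    Finset.sum_smul, Finset.sum_add_distrib, Finset.sum_sub_distrib, Finset.sum_neg_distrib, h1]
  abel

theorem Holds.defectB_eq (h : s.Holds a b c) (j : Fin p) :
    s.defectB a b c j = b j * c
      - (∑ k, s.lam k j • a k + ∑ k, s.u j k • b k + s.w' j • (1 : X)) := by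
  have h1 : ∑ i, ∑ k, ∑ l, (s.phi j i k * s.psi k i l) • b l =
      ∑ l, ∑ i, ∑ k, (s.psi k i l * s.phi j i k) • b l := by
    rw [Finset.sum_congr rfl fun i _ => Finset.sum_comm, Finset.sum_comm]
    simp only [mul_comm]
  simp only [defectB, h.b_mul_b, u, w', smul_add, Finset.smul_sum, smul_smul, sub_smul, neg_smul,
    Finset.sum_smul, Finset.sum_add_distrib, Finset.sum_sub_distrib, Finset.sum_neg_distrib, h1]
  abel

end MConstants

/-- A basis `A₁, …, Aₚ, B¹, …, Bᵖ, 1, C` of a vector space together with its coordinate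
functionals `α, β, γ, ε`. -/
structure MCoordinates (L : Type u) [AddCommGroup L] [Module ℂ L] (p : ℕ) where
  A : Fin p → L
  B : Fin p → L
  e : L
  C : L
  α : Fin p → L →ₗ[ℂ] ℂ
  β : Fin p → L →ₗ[ℂ] ℂ
  γ : L →ₗ[ℂ] ℂ
  ε : L →ₗ[ℂ] ℂ
  α_A : ∀ i j, α i (A j) = if i = j then 1 else 0
  α_B : ∀ i j, α i (B j) = 0
  α_e : ∀ i, α i e = 0
  α_C : ∀ i, α i C = 0
  β_A : ∀ i j, β i (A j) = 0
  β_B : ∀ i j, β i (B j) = if i = j then 1 else 0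
  β_e : ∀ i, β i e = 0
  β_C : ∀ i, β i C = 0
  γ_A : ∀ i, γ (A i) = 0
  γ_B : ∀ i, γ (B i) = 0
  γ_e : γ e = 1
  γ_C : γ C = 0
  ε_A : ∀ i, ε (A i) = 0
  ε_B : ∀ i, ε (B i) = 0
  ε_e : ε e = 0
  ε_C : ε C = 1
  expansion : ∀ v, v = ∑ j, α j v • A j + ∑ j, β j v • B j + γ v • e + ε v • C

namespace MCoordinates

attribute [simp] α_A α_B α_e α_C β_A β_B β_e β_C γ_A γ_B γ_e γ_C ε_A ε_B ε_e ε_C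

/-- The space of coordinates, in an arbitrary universe. -/
noncomputable def model (p : ℕ) :
    MCoordinates (ULift.{u} ((Fin p → ℂ) × (Fin p → ℂ) × ℂ × ℂ)) p where
  A i := ⟨(Pi.single i 1, 0, 0, 0)⟩
  B i := ⟨(0, Pi.single i 1, 0, 0)⟩
  e := ⟨(0, 0, 1, 0)⟩
  C := ⟨(0, 0, 0, 1)⟩
  α i := LinearMap.proj i ∘ₗ LinearMap.fst ℂ _ _ ∘ₗ ULift.moduleEquiv.toLinearMap
  β i := LinearMap.proj i ∘ₗ LinearMap.fst ℂ _ _ ∘ₗ LinearMap.snd ℂ _ _ ∘ₗ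
    ULift.moduleEquiv.toLinearMap
  γ := LinearMap.fst ℂ _ _ ∘ₗ LinearMap.snd ℂ _ _ ∘ₗ LinearMap.snd ℂ _ _ ∘ₗ
    ULift.moduleEquiv.toLinearMap
  ε := LinearMap.snd ℂ _ _ ∘ₗ LinearMap.snd ℂ _ _ ∘ₗ LinearMap.snd ℂ _ _ ∘ₗ
    ULift.moduleEquiv.toLinearMap
  α_A i j := by simp [Pi.single_apply]
  α_B i j := by simp
  α_e i := by simp
  α_C i := by simp
  β_A i j := by simp
  β_B i j := by simp [Pi.single_apply]
  β_e i := by simp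
  β_C i := by simp
  γ_A i := by simp
  γ_B i := by simp
  γ_e := by simp
  γ_C := by simp
  ε_A i := by simp
  ε_B i := by simp
  ε_e := by simp
  ε_C := by simp
  expansion v := by
    apply ULift.moduleEquiv (R := ℂ).injective
    simp only [map_add, map_sum, map_smul]
    ext i <;> simp [Prod.fst_sum, Prod.snd_sum, Pi.single_apply]

variable {L : Type u} [AddCommGroup L] [Module ℂ L] {p : ℕ} (K : MCoordinates L p)

/-- The form for which `A₁, …, Aₚ, 1` and `B¹, …, Bᵖ, C` are dual isotropic families. -/
noncomputable def form : L →ₗ[ℂ] L →ₗ[ℂ] ℂ :=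
  ∑ j, (K.α j).smulRight (K.β j) + ∑ j, (K.β j).smulRight (K.α j) + K.γ.smulRight K.ε
    + K.ε.smulRight K.γ

theorem form_apply (v v' : L) : K.form v v' = ∑ j, K.α j v * K.β j v' + ∑ j, K.β j v * K.α j v'
    + K.γ v * K.ε v' + K.ε v * K.γ v' := by
  simp [form]

theorem form_symm (v v' : L) : K.form v v' = K.form v' v := by
  simp only [form_apply, mul_comm]
  ring

@[simp] theorem form_right_A (v : L) (i : Fin p) : K.form v (K.A i) = K.β i v := by
  simp [form_apply]

@[simp] theorem form_right_B (v : L) (i : Fin p) : K.form v (K.B i) = K.α i v := by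
  simp [form_apply]

@[simp] theorem form_right_e (v : L) : K.form v K.e = K.ε v := by
  simp [form_apply]

@[simp] theorem form_right_C (v : L) : K.form v K.C = K.γ v := by
  simp [form_apply]

/-- The subspace spanned by `1, A₁, …, Aₚ`. -/
noncomputable def subA : Submodule ℂ L := (⨅ i, LinearMap.ker (K.β i)) ⊓ LinearMap.ker K.ε

/-- The subspace spanned by `1, B¹, …, Bᵖ`. -/
noncomputable def subB : Submodule ℂ L := (⨅ i, LinearMap.ker (K.α i)) ⊓ LinearMap.ker K.ε

theorem mem_subA {v : L} : v ∈ K.subA ↔ (∀ i, K.β i v = 0) ∧ K.ε v = 0 := by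
  simp [subA]

theorem mem_subB {v : L} : v ∈ K.subB ↔ (∀ i, K.α i v = 0) ∧ K.ε v = 0 := by
  simp [subB]

theorem expansion_A {v : L} (hv : v ∈ K.subA) : v = ∑ j, K.α j v • K.A j + K.γ v • K.e := by
  rw [mem_subA] at hv
  conv_lhs => rw [K.expansion v]
  simp [hv]

theorem expansion_B {v : L} (hv : v ∈ K.subB) : v = ∑ j, K.β j v • K.B j + K.γ v • K.e := by
  rw [mem_subB] at hv
  conv_lhs => rw [K.expansion v]
  simp [hv]

/-- Linear maps that agree at `1, A₁, …, Aₚ` agree on `𝒜`. -/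
theorem ext_subA {Y : Type*} [AddCommGroup Y] [Module ℂ Y] (f g : L →ₗ[ℂ] Y)
    (he : f K.e = g K.e) (hA : ∀ i, f (K.A i) = g (K.A i)) {v : L} (hv : v ∈ K.subA) :
    f v = g v := by
  rw [K.expansion_A hv]
  simp [he, hA]

theorem ext_subB {Y : Type*} [AddCommGroup Y] [Module ℂ Y] (f g : L →ₗ[ℂ] Y)
    (he : f K.e = g K.e) (hB : ∀ i, f (K.B i) = g (K.B i)) {v : L} (hv : v ∈ K.subB) :
    f v = g v := by
  rw [K.expansion_B hv]
  simp [he, hB]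

theorem ext_all {Y : Type*} [AddCommGroup Y] [Module ℂ Y] (f g : L →ₗ[ℂ] Y)
    (he : f K.e = g K.e) (hA : ∀ i, f (K.A i) = g (K.A i)) (hB : ∀ i, f (K.B i) = g (K.B i))
    (hC : f K.C = g K.C) (v : L) : f v = g v := by
  rw [K.expansion v]
  simp [he, hA, hB, hC]

variable (s : MConstants p)

/-- The vector `Aᵢ Aⱼ`. -/
noncomputable def mulAA (i j : Fin p) : L := ∑ k, s.phi k i j • K.A k + s.mu i j • K.e

/-- The vector `Bⁱ Bʲ`. -/
noncomputable def mulBB (i j : Fin p) : L := ∑ k, s.psi i j k • K.B k + s.lam i j • K.e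

/-- The vector `Bⁱ Aⱼ`. -/
noncomputable def mulBA (i j : Fin p) : L :=
  ∑ k, s.psi k i j • K.A k + ∑ k, s.phi i j k • K.B k + s.t i j • K.e
    + (if i = j then 1 else 0 : ℂ) • K.C

/-- The vector `C Aⱼ`. -/
noncomputable def mulCA (j : Fin p) : L :=
  ∑ k, s.u k j • K.A k + ∑ k, s.mu j k • K.B k + s.w j • K.e

/-- The vector `Bⁱ C`. -/
noncomputable def mulBC (j : Fin p) : L :=
  ∑ k, s.lam k j • K.A k + ∑ k, s.u j k • K.B k + s.w' j • K.e

/-- The right action of `𝒜`, extended to a bilinear map by zero at the `Bⁱ` and at `C`. -/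
noncomputable def ract : L →ₗ[ℂ] L →ₗ[ℂ] L :=
  (K.γ.smulRight LinearMap.id + ∑ j, (K.α j).smulRight (K.γ.smulRight (K.A j)
    + ∑ i, (K.α i).smulRight (K.mulAA s i j) + ∑ i, (K.β i).smulRight (K.mulBA s i j)
    + K.ε.smulRight (K.mulCA s j))).flip

/-- The left action of `ℬ`, extended to a bilinear map by zero at the `Aᵢ` and at `C`. -/
noncomputable def lact : L →ₗ[ℂ] L →ₗ[ℂ] L :=
  K.γ.smulRight LinearMap.id + ∑ i, (K.β i).smulRight (K.γ.smulRight (K.B i)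
    + ∑ j, (K.α j).smulRight (K.mulBA s i j) + ∑ j, (K.β j).smulRight (K.mulBB s i j)
    + K.ε.smulRight (K.mulBC s i))

theorem ract_apply (v a : L) : K.ract s v a = K.γ a • v + ∑ j, K.α j a • (K.γ v • K.A j
    + ∑ i, K.α i v • K.mulAA s i j + ∑ i, K.β i v • K.mulBA s i j + K.ε v • K.mulCA s j) := by
  simp [ract]

theorem lact_apply (b v : L) : K.lact s b v = K.γ b • v + ∑ i, K.β i b • (K.γ v • K.B i
    + ∑ j, K.α j v • K.mulBA s i j + ∑ j, K.β j v • K.mulBB s i j + K.ε v • K.mulBC s i) := by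
  simp [lact]

@[simp] theorem ract_e (v : L) : K.ract s v K.e = v := by
  simp [ract_apply]

@[simp] theorem ract_e_A (j : Fin p) : K.ract s K.e (K.A j) = K.A j := by
  simp [ract_apply]

@[simp] theorem ract_A_A (i j : Fin p) : K.ract s (K.A i) (K.A j) = K.mulAA s i j := by
  simp [ract_apply]

@[simp] theorem ract_B_A (i j : Fin p) : K.ract s (K.B i) (K.A j) = K.mulBA s i j := by
  simp [ract_apply]

@[simp] theorem ract_C_A (j : Fin p) : K.ract s K.C (K.A j) = K.mulCA s j := by
  simp [ract_apply]

@[simp] theorem lact_e (v : L) : K.lact s K.e v = v := by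
  simp [lact_apply]

@[simp] theorem lact_B_e (j : Fin p) : K.lact s (K.B j) K.e = K.B j := by
  simp [lact_apply]

@[simp] theorem lact_B_A (i j : Fin p) : K.lact s (K.B i) (K.A j) = K.mulBA s i j := by
  simp [lact_apply]

@[simp] theorem lact_B_B (i j : Fin p) : K.lact s (K.B i) (K.B j) = K.mulBB s i j := by
  simp [lact_apply]

@[simp] theorem lact_B_C (j : Fin p) : K.lact s (K.B j) K.C = K.mulBC s j := by
  simp [lact_apply]

theorem e_mem_subA : K.e ∈ K.subA := by simp [mem_subA]
theorem e_mem_subB : K.e ∈ K.subB := by simp [mem_subB]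
theorem A_mem_subA (i : Fin p) : K.A i ∈ K.subA := by simp [mem_subA]
theorem B_mem_subB (i : Fin p) : K.B i ∈ K.subB := by simp [mem_subB]

theorem form_subA {v w : L} (hv : v ∈ K.subA) (hw : w ∈ K.subA) : K.form v w = 0 := by
  rw [mem_subA] at hv hw
  simp [form_apply, hv, hw]

theorem form_subB {v w : L} (hv : v ∈ K.subB) (hw : w ∈ K.subB) : K.form v w = 0 := by
  rw [mem_subB] at hv hw
  simp [form_apply, hv, hw]

theorem form_ract (v : L) {a a' : L} (ha : a ∈ K.subA) (ha' : a' ∈ K.subA) :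
    K.form v (K.ract s a a') = K.form (K.ract s v a) a' := by
  refine K.ext_subA (K.form v ∘ₗ K.ract s a) (K.form (K.ract s v a)) ?_ (fun k => ?_) ha'
  · refine K.ext_subA (K.form v ∘ₗ (K.ract s).flip K.e) (K.form.flip K.e ∘ₗ K.ract s v) ?_
      (fun j => ?_) ha
    · simp
    · refine K.ext_all (K.form.flip (K.ract s (K.A j) K.e))
        (K.form.flip K.e ∘ₗ (K.ract s).flip (K.A j)) ?_ (fun i => ?_) (fun i => ?_) ?_ v
      all_goals simp [-ite_smul, mulAA, mulBA, mulCA]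
      all_goals try simp only [eq_comm]
  · refine K.ext_subA (K.form v ∘ₗ (K.ract s).flip (K.A k)) (K.form.flip (K.A k) ∘ₗ K.ract s v) ?_
      (fun j => ?_) ha
    · simp
    · refine K.ext_all (K.form.flip (K.ract s (K.A j) (K.A k)))
        (K.form.flip (K.A k) ∘ₗ (K.ract s).flip (K.A j)) ?_ (fun i => ?_) (fun i => ?_) ?_ v
      all_goals simp [-ite_smul, mulAA, mulBA, mulCA]

theorem form_lact (v : L) {b b' : L} (hb : b ∈ K.subB) (hb' : b' ∈ K.subB) :
    K.form (K.lact s b b') v = K.form b (K.lact s b' v) := by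
  rw [K.form_symm, K.form_symm b]
  refine K.ext_subB (K.form v ∘ₗ (K.lact s).flip b') (K.form (K.lact s b' v)) ?_ (fun k => ?_) hb
  · refine K.ext_subB (K.form v ∘ₗ K.lact s K.e) (K.form.flip K.e ∘ₗ (K.lact s).flip v) ?_
      (fun j => ?_) hb'
    · simp
    · refine K.ext_all (K.form.flip (K.lact s K.e (K.B j)))
        (K.form.flip K.e ∘ₗ K.lact s (K.B j)) ?_ (fun i => ?_) (fun i => ?_) ?_ v
      all_goals simp [-ite_smul, mulBB, mulBA, mulBC]
  · refine K.ext_subB (K.form v ∘ₗ K.lact s (K.B k)) (K.form.flip (K.B k) ∘ₗ (K.lact s).flip v) ?_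
      (fun j => ?_) hb'
    · simp
    · refine K.ext_all (K.form.flip (K.lact s (K.B k) (K.B j)))
        (K.form.flip (K.B k) ∘ₗ K.lact s (K.B j)) ?_ (fun i => ?_) (fun i => ?_) ?_ v
      all_goals simp [-ite_smul, mulBB, mulBA, mulBC]

/-- The two actions are adjoint to each other. -/
theorem form_lact_eq_form_ract (v : L) {a b : L} (ha : a ∈ K.subA) (hb : b ∈ K.subB) :
    K.form (K.lact s b v) a = K.form b (K.ract s v a) := by
  refine K.ext_subA (K.form (K.lact s b v)) (K.form b ∘ₗ K.ract s v) ?_ (fun k => ?_) ha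
  · refine K.ext_subB (K.form.flip K.e ∘ₗ (K.lact s).flip v) (K.form.flip (K.ract s v K.e)) ?_
      (fun j => ?_) hb
    · simp [K.form_symm K.e]
    · refine K.ext_all (K.form.flip K.e ∘ₗ K.lact s (K.B j))
        (K.form (K.B j) ∘ₗ (K.ract s).flip K.e) ?_ (fun i => ?_) (fun i => ?_) ?_ v
      all_goals simp [-ite_smul, mulBB, mulBA, mulBC]
      all_goals try simp only [eq_comm]
  · refine K.ext_subB (K.form.flip (K.A k) ∘ₗ (K.lact s).flip v)
      (K.form.flip (K.ract s v (K.A k))) ?_ (fun j => ?_) hb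
    · refine K.ext_all (K.form.flip (K.A k) ∘ₗ K.lact s K.e)
        (K.form K.e ∘ₗ (K.ract s).flip (K.A k)) ?_ (fun i => ?_) (fun i => ?_) ?_ v
      all_goals simp [-ite_smul, mulAA, mulBA, mulCA, K.form_symm K.e]
      all_goals try simp only [eq_comm]
    · refine K.ext_all (K.form.flip (K.A k) ∘ₗ K.lact s (K.B j))
        (K.form (K.B j) ∘ₗ (K.ract s).flip (K.A k)) ?_ (fun i => ?_) (fun i => ?_) ?_ v
      all_goals simp [-ite_smul, mulAA, mulBA, mulCA, mulBB, mulBC, K.form_symm (K.B j)]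

theorem ract_mem_subA {a a' : L} (ha : a ∈ K.subA) (ha' : a' ∈ K.subA) :
    K.ract s a a' ∈ K.subA := by
  rw [K.expansion_A ha, K.expansion_A ha']
  simp only [map_add, map_sum, map_smul, LinearMap.add_apply, LinearMap.sum_apply,
    LinearMap.smul_apply, ract_e, ract_e_A, ract_A_A, mulAA]
  have hA := K.A_mem_subA
  have he := K.e_mem_subA
  refine add_mem (sum_mem fun j _ => K.subA.smul_mem _ (add_mem (sum_mem fun i _ =>
    K.subA.smul_mem _ (add_mem (sum_mem fun k _ => K.subA.smul_mem _ (hA k))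
    (K.subA.smul_mem _ he))) (K.subA.smul_mem _ (hA j)))) (K.subA.smul_mem _ (add_mem
    (sum_mem fun i _ => K.subA.smul_mem _ (hA i)) (K.subA.smul_mem _ he)))

theorem lact_mem_subB {b b' : L} (hb : b ∈ K.subB) (hb' : b' ∈ K.subB) :
    K.lact s b b' ∈ K.subB := by
  rw [K.expansion_B hb, K.expansion_B hb']
  simp only [map_add, map_sum, map_smul, LinearMap.add_apply, LinearMap.sum_apply,
    LinearMap.smul_apply, lact_e, lact_B_e, lact_B_B, mulBB]
  have hB := K.B_mem_subB
  have he := K.e_mem_subB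
  refine add_mem (sum_mem fun j _ => K.subB.smul_mem _ (add_mem (sum_mem fun i _ =>
    K.subB.smul_mem _ (add_mem (sum_mem fun k _ => K.subB.smul_mem _ (hB k))
    (K.subB.smul_mem _ he))) (K.subB.smul_mem _ (hB j)))) (K.subB.smul_mem _ (add_mem
    (sum_mem fun i _ => K.subB.smul_mem _ (hB i)) (K.subB.smul_mem _ he)))

end MCoordinates

/-! ### The axioms of a weak `M`-structure for given structure constants -/

namespace MCoordinates

section Representation

variable {L : Type u} [AddCommGroup L] [Module ℂ L] {p : ℕ} (K : MCoordinates L p)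
  {s : MConstants p} {X : Type v} [Ring X] [Algebra ℂ X] {a b : Fin p → X} {c : X}

/-- The linear map that sends the basis `Aᵢ, Bⁱ, 1, C` to `aᵢ, bⁱ, 1, c`. -/
noncomputable def rep (a b : Fin p → X) (c : X) : L →ₗ[ℂ] X :=
  ∑ i, (K.α i).smulRight (a i) + ∑ i, (K.β i).smulRight (b i) + K.γ.smulRight 1 + K.ε.smulRight c

theorem rep_apply (v : L) : K.rep a b c v =
    ∑ i, K.α i v • a i + ∑ i, K.β i v • b i + K.γ v • 1 + K.ε v • c := by
  simp [rep]

@[simp] theorem rep_A (i : Fin p) : K.rep a b c (K.A i) = a i := by simp [rep_apply]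
@[simp] theorem rep_B (i : Fin p) : K.rep a b c (K.B i) = b i := by simp [rep_apply]
@[simp] theorem rep_e : K.rep a b c K.e = 1 := by simp [rep_apply]
@[simp] theorem rep_C : K.rep a b c K.C = c := by simp [rep_apply]

/-- The structure constants hold for `aᵢ, bⁱ, c`, and `∑ aᵢ bⁱ + c` commutes with the `aᵢ` and
the `bⁱ`. -/
structure _root_.MConstants.CentralHolds (s : MConstants p) (a b : Fin p → X) (c : X) : Prop
    extends s.Holds a b c where
  defectA_eq_zero : ∀ j, s.defectA a b c j = 0
  defectB_eq_zero : ∀ j, s.defectB a b c j = 0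

theorem rep_ract (h : s.CentralHolds a b c) (v : L) {x : L} (hx : x ∈ K.subA) :
    K.rep a b c (K.ract s v x) = K.rep a b c v * K.rep a b c x := by
  have hc := fun j => sub_eq_zero.1 ((h.defectA_eq j).symm.trans (h.defectA_eq_zero j))
  refine K.ext_subA (K.rep a b c ∘ₗ K.ract s v)
    (LinearMap.mulLeft ℂ (K.rep a b c v) ∘ₗ K.rep a b c) ?_ (fun j => ?_) hx
  · simp
  · refine K.ext_all (K.rep a b c ∘ₗ (K.ract s).flip (K.A j))
      (LinearMap.mulRight ℂ (K.rep a b c (K.A j)) ∘ₗ K.rep a b c) ?_ (fun i => ?_) (fun i => ?_)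
      ?_ v
    all_goals simp [mulAA, mulBA, mulCA, h.a_mul_a, h.b_mul_a, hc, apply_ite (K.rep a b c)]

theorem rep_lact (h : s.CentralHolds a b c) (v : L) {x : L} (hx : x ∈ K.subB) :
    K.rep a b c (K.lact s x v) = K.rep a b c x * K.rep a b c v := by
  have hc := fun j => sub_eq_zero.1 ((h.defectB_eq j).symm.trans (h.defectB_eq_zero j))
  refine K.ext_subB (K.rep a b c ∘ₗ (K.lact s).flip v)
    (LinearMap.mulRight ℂ (K.rep a b c v) ∘ₗ K.rep a b c) ?_ (fun j => ?_) hx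
  · simp
  · refine K.ext_all (K.rep a b c ∘ₗ K.lact s (K.B j))
      (LinearMap.mulLeft ℂ (K.rep a b c (K.B j)) ∘ₗ K.rep a b c) ?_ (fun i => ?_) (fun i => ?_)
      ?_ v
    all_goals simp [mulBB, mulBA, mulBC, h.b_mul_b, h.b_mul_a, hc, apply_ite (K.rep a b c)]

theorem eq_zero_of_rep_subA (ha : LinearIndependent ℂ (Fin.cons 1 a : Fin (p + 1) → X)) {v : L}
    (hv : v ∈ K.subA) (h0 : K.rep a b c v = 0) : v = 0 := by
  rw [K.expansion_A hv] at h0 ⊢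
  have h1 := Fintype.linearIndependent_iff.1 ha (Fin.cons (K.γ v) fun j => K.α j v)
    (by simpa [Fin.sum_univ_succ, add_comm] using h0)
  have h2 : K.γ v = 0 := h1 0
  have h3 : ∀ j, K.α j v = 0 := fun j => h1 j.succ
  simp [h2, h3]

theorem eq_zero_of_rep_subB (hb : LinearIndependent ℂ (Fin.cons 1 b : Fin (p + 1) → X)) {v : L}
    (hv : v ∈ K.subB) (h0 : K.rep a b c v = 0) : v = 0 := by
  rw [K.expansion_B hv] at h0 ⊢
  have h1 := Fintype.linearIndependent_iff.1 hb (Fin.cons (K.γ v) fun j => K.β j v)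
    (by simpa [Fin.sum_univ_succ, add_comm] using h0)
  have h2 : K.γ v = 0 := h1 0
  have h3 : ∀ j, K.β j v = 0 := fun j => h1 j.succ
  simp [h2, h3]

theorem mem_subA_of_form {v : L} (h : ∀ x ∈ K.subA, K.form v x = 0) : v ∈ K.subA :=
  K.mem_subA.2 ⟨fun i => by simpa using h _ (K.A_mem_subA i), by simpa using h _ K.e_mem_subA⟩

theorem mem_subB_of_form {v : L} (h : ∀ x ∈ K.subB, K.form v x = 0) : v ∈ K.subB :=
  K.mem_subB.2 ⟨fun i => by simpa using h _ (K.B_mem_subB i), by simpa using h _ K.e_mem_subB⟩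

/-- A vector is determined by its image in `X` and its products with `𝒜`, as `𝒜` is its own
orthogonal complement and is embedded into `X`. -/
theorem eq_of_rep_of_form_subA (ha : LinearIndependent ℂ (Fin.cons 1 a : Fin (p + 1) → X))
    {v w : L} (h0 : K.rep a b c v = K.rep a b c w)
    (h1 : ∀ x ∈ K.subA, K.form v x = K.form w x) : v = w := by
  rw [← sub_eq_zero]
  refine K.eq_zero_of_rep_subA (b := b) (c := c) ha (K.mem_subA_of_form fun x hx => ?_) ?_
  · rw [map_sub, LinearMap.sub_apply, h1 x hx, sub_self]
  · rw [map_sub, h0, sub_self]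

theorem eq_of_rep_of_form_subB (hb : LinearIndependent ℂ (Fin.cons 1 b : Fin (p + 1) → X))
    {v w : L} (h0 : K.rep a b c v = K.rep a b c w)
    (h1 : ∀ x ∈ K.subB, K.form v x = K.form w x) : v = w := by
  rw [← sub_eq_zero]
  refine K.eq_zero_of_rep_subB (a := a) (c := c) hb (K.mem_subB_of_form fun x hx => ?_) ?_
  · rw [map_sub, LinearMap.sub_apply, h1 x hx, sub_self]
  · rw [map_sub, h0, sub_self]

theorem ract_ract (h : s.CentralHolds a b c)
    (ha : LinearIndependent ℂ (Fin.cons 1 a : Fin (p + 1) → X)) (v : L) {x y : L} (hx : x ∈ K.subA) (hy : y ∈ K.subA) :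
    K.ract s v (K.ract s x y) = K.ract s (K.ract s v x) y := by
  have hrep : ∀ v, ∀ x ∈ K.subA, ∀ y ∈ K.subA, K.rep a b c (K.ract s v (K.ract s x y)) =
      K.rep a b c (K.ract s (K.ract s v x) y) := by
    intro v x hx y hy
    rw [K.rep_ract h _ (K.ract_mem_subA s hx hy), K.rep_ract h _ hy, K.rep_ract h _ hy,
      K.rep_ract h _ hx, mul_assoc]
  refine K.eq_of_rep_of_form_subA ha (hrep v x hx y hy) fun z hz => ?_
  have hz' := K.ract_mem_subA s hy hz
  -- the product of `𝒜` is associative, as `𝒜` is embedded into `X`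
  have hassoc : K.ract s x (K.ract s y z) = K.ract s (K.ract s x y) z :=
    K.eq_of_rep_of_form_subA ha (hrep x y hy z hz) fun t ht => by
      rw [K.form_subA (K.ract_mem_subA s hx hz') ht,
        K.form_subA (K.ract_mem_subA s (K.ract_mem_subA s hx hy) hz) ht]
  rw [← K.form_ract s _ (K.ract_mem_subA s hx hy) hz, ← K.form_ract s _ hy hz,
    ← K.form_ract s _ hx hz', hassoc]

theorem lact_lact (h : s.CentralHolds a b c)
    (hb : LinearIndependent ℂ (Fin.cons 1 b : Fin (p + 1) → X)) (v : L) {x y : L} (hx : x ∈ K.subB) (hy : y ∈ K.subB) :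
    K.lact s (K.lact s x y) v = K.lact s x (K.lact s y v) := by
  have hrep : ∀ v, ∀ x ∈ K.subB, ∀ y ∈ K.subB, K.rep a b c (K.lact s (K.lact s x y) v) =
      K.rep a b c (K.lact s x (K.lact s y v)) := by
    intro v x hx y hy
    rw [K.rep_lact h _ (K.lact_mem_subB s hx hy), K.rep_lact h _ hx, K.rep_lact h _ hx,
      K.rep_lact h _ hy, mul_assoc]
  refine K.eq_of_rep_of_form_subB hb (hrep v x hx y hy) fun z hz => ?_
  have hz' := K.lact_mem_subB s hz hx
  have hassoc : K.lact s (K.lact s z x) y = K.lact s z (K.lact s x y) :=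
    K.eq_of_rep_of_form_subB hb (hrep y z hz x hx) fun t ht => by
      rw [K.form_subB (K.lact_mem_subB s hz' hy) ht,
        K.form_subB (K.lact_mem_subB s hz (K.lact_mem_subB s hx hy)) ht]
  rw [K.form_symm _ z, K.form_symm _ z, ← K.form_lact s _ hz (K.lact_mem_subB s hx hy),
    ← K.form_lact s _ hz hx, ← K.form_lact s _ hz' hy, hassoc]

theorem ract_lact (h : s.CentralHolds a b c)
    (ha : LinearIndependent ℂ (Fin.cons 1 a : Fin (p + 1) → X)) (v : L) {x y : L} (hx : x ∈ K.subA) (hy : y ∈ K.subB) :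
    K.ract s (K.lact s y v) x = K.lact s y (K.ract s v x) := by
  refine K.eq_of_rep_of_form_subA (b := b) (c := c) ha ?_ fun z hz => ?_
  · rw [K.rep_ract h _ hx, K.rep_lact h _ hy, K.rep_lact h _ hy, K.rep_ract h _ hx, mul_assoc]
  · rw [← K.form_ract s _ hx hz, K.form_lact_eq_form_ract s _ (K.ract_mem_subA s hx hz) hy,
      K.form_lact_eq_form_ract s _ hz hy, K.ract_ract h ha v hx hz]

theorem subA_inf_subB : K.subA ⊓ K.subB = Submodule.span ℂ {K.e} := by
  refine le_antisymm (fun v hv => ?_) ?_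
  · have hA := K.mem_subA.1 hv.1
    have hB := K.mem_subB.1 hv.2
    rw [K.expansion v]
    simp only [hA, hB, zero_smul, Finset.sum_const_zero, add_zero, zero_add]
    exact Submodule.smul_mem _ _ (Submodule.mem_span_singleton_self _)
  · rw [Submodule.span_singleton_le_iff_mem]
    exact ⟨K.e_mem_subA, K.e_mem_subB⟩

theorem subA_sup_subB : K.subA ⊔ K.subB = LinearMap.ker K.ε := by
  refine le_antisymm (sup_le (fun v hv => (K.mem_subA.1 hv).2) fun v hv => (K.mem_subB.1 hv).2)
    fun v hv => ?_
  rw [LinearMap.mem_ker] at hv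
  rw [K.expansion v, hv, zero_smul, add_zero, add_assoc]
  exact Submodule.add_mem_sup
    (sum_mem fun i _ => Submodule.smul_mem _ _ (K.A_mem_subA i))
    (add_mem (sum_mem fun i _ => Submodule.smul_mem _ _ (K.B_mem_subB i))
      (Submodule.smul_mem _ _ K.e_mem_subB))

theorem finrank_quotient : Module.finrank ℂ (L ⧸ (K.subA ⊔ K.subB)) = 1 := by
  have hsurj : Function.Surjective K.ε := fun r => ⟨r • K.C, by simp⟩
  rw [subA_sup_subB, (LinearMap.quotKerEquivOfSurjective K.ε hsurj).finrank_eq,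
    Module.finrank_self]

theorem e_ne_zero : K.e ≠ 0 := fun h0 => by simpa [h0] using K.γ_e

theorem ract_e_of_mem {x : L} (hx : x ∈ K.subA) : K.ract s K.e x = x :=
  K.ext_subA (K.ract s K.e) LinearMap.id (by simp) (by simp) hx

theorem lact_e_of_mem {x : L} (hx : x ∈ K.subB) : K.lact s x K.e = x :=
  K.ext_subB ((K.lact s).flip K.e) LinearMap.id (by simp) (by simp) hx

/-- The weak `M`-structure on `L` with the given structure constants. -/
noncomputable def toWeakMStructure (h : s.CentralHolds a b c)
    (ha : LinearIndependent ℂ (Fin.cons 1 a : Fin (p + 1) → X))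
    (hb : LinearIndependent ℂ (Fin.cons 1 b : Fin (p + 1) → X)) : WeakMStructure L where
  subA := K.subA
  subB := K.subB
  unit := K.e
  form := K.form
  mulA := LinearMap.mk₂ ℂ (fun x y => ⟨K.ract s x y, K.ract_mem_subA s x.2 y.2⟩)
    (fun x y z => by ext; simp) (fun r x y => by ext; simp) (fun x y z => by ext; simp)
    (fun r x y => by ext; simp)
  mulB := LinearMap.mk₂ ℂ (fun x y => ⟨K.lact s x y, K.lact_mem_subB s x.2 y.2⟩)
    (fun x y z => by ext; simp) (fun r x y => by ext; simp) (fun x y z => by ext; simp)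
    (fun r x y => by ext; simp)
  lact := K.lact s ∘ₗ K.subB.subtype
  ract := (K.ract s).compl₂ K.subA.subtype
  unit_mem_subA := K.e_mem_subA
  unit_mem_subB := K.e_mem_subB
  form_symm := K.form_symm
  form_nondegenerate v hv := by
    have h1 := fun i => hv (K.A i)
    have h2 := fun i => hv (K.B i)
    have h3 := hv K.e
    have h4 := hv K.C
    simp only [form_right_A, form_right_B, form_right_e, form_right_C] at h1 h2 h3 h4
    rw [K.expansion v]
    simp [h1, h2, h3, h4]
  mulA_assoc x y z := Subtype.ext (K.ract_ract h ha x y.2 z.2).symm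
  unit_mulA x := Subtype.ext (K.ract_e_of_mem x.2)
  mulA_unit x := Subtype.ext (K.ract_e s x)
  mulB_assoc x y z := Subtype.ext (K.lact_lact h hb z x.2 y.2)
  unit_mulB x := Subtype.ext (K.lact_e s x)
  mulB_unit x := Subtype.ext (K.lact_e_of_mem x.2)
  unit_lact v := K.lact_e s v
  mulB_lact x y v := K.lact_lact h hb v x.2 y.2
  ract_unit v := K.ract_e s v
  ract_mulA v x y := K.ract_ract h ha v x.2 y.2
  act_comm x v y := K.ract_lact h ha v y.2 x.2
  finrank_inf := by rw [K.subA_inf_subB, finrank_span_singleton K.e_ne_zero]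
  finrank_quot := K.finrank_quotient
  inf_eq_span := K.subA_inf_subB
  lact_eq_mulB x y := rfl
  ract_eq_mulA x y := rfl
  form_subA x y := K.form_subA x.2 y.2
  form_subB x y := K.form_subB x.2 y.2
  form_mulB x y v := K.form_lact s v x.2 y.2
  form_mulA v x y := K.form_ract s v x.2 y.2

end Representation

end MCoordinates

/-! ### Centrality and non-degeneracy -/

namespace WeakMStructure

variable {L : Type u} [AddCommGroup L] [Module ℂ L] {S : WeakMStructure L}

/-- An element of `U(L)` that commutes with the image of `L` is central. -/
theorem mem_center_of_commute {z : S.U} (hz : ∀ v, Commute z (S.toU v)) :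
    z ∈ Subalgebra.center ℂ S.U := by
  rw [Subalgebra.mem_center_iff]
  intro x
  obtain ⟨t, rfl⟩ := RingQuot.mkAlgHom_surjective ℂ S.Rel x
  suffices h : Commute z (RingQuot.mkAlgHom ℂ S.Rel t) from h.eq.symm
  induction t using TensorAlgebra.induction with
  | algebraMap r => rw [AlgHom.commutes]; exact (Algebra.commutes r z).symm
  | ι v => exact hz v
  | mul x y hx hy => rw [map_mul]; exact hx.mul_right hy
  | add x y hx hy => rw [map_add]; exact hx.add_right hy

/-- It suffices that `∑ Aᵢ Bⁱ + C` commutes with the `Aᵢ` and the `Bⁱ`: it then commutes with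
`C`, its own difference with `∑ Aᵢ Bⁱ`. -/
theorem IsFrame.isMStructure {p : ℕ} {A B : Fin p → L} {C : L} (h : S.IsFrame A B C)
    (hA : ∀ j, Commute (∑ i, S.toU (A i) * S.toU (B i) + S.toU C) (S.toU (A j)))
    (hB : ∀ j, Commute (∑ i, S.toU (A i) * S.toU (B i) + S.toU C) (S.toU (B j))) :
    S.IsMStructure := by
  intro F
  have hF : F.K = ∑ i, S.toU (A i) * S.toU (B i) + S.toU C := h.sum_mul_add_eq F.isFrame
  rw [hF]
  refine mem_center_of_commute fun v => ?_
  generalize hz : ∑ i, S.toU (A i) * S.toU (B i) + S.toU C = z at hA hB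
  have hC : Commute z (S.toU C) := by
    rw [← eq_sub_iff_add_eq'] at hz
    rw [hz]
    exact (Commute.refl z).sub_right (Commute.sum_right _ _ _ fun i _ => (hA i).mul_right (hB i))
  rw [h.expansion v]
  simp only [map_add, map_sum, map_smul, toU_unit]
  exact (((Commute.sum_right _ _ _ fun i _ => (hA i).smul_right _).add_right
    (Commute.sum_right _ _ _ fun i _ => (hB i).smul_right _)).add_right
    ((Commute.one_right z).smul_right _)).add_right (hC.smul_right _)

end WeakMStructure

namespace MCoordinates

variable {L : Type u} [AddCommGroup L] [Module ℂ L] {p : ℕ} (K : MCoordinates L p)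
  {s : MConstants p} {X : Type v} [Ring X] [Algebra ℂ X] {a b : Fin p → X} {c : X}

theorem isFrame (h : s.CentralHolds a b c)
    (ha : LinearIndependent ℂ (Fin.cons 1 a : Fin (p + 1) → X))
    (hb : LinearIndependent ℂ (Fin.cons 1 b : Fin (p + 1) → X)) :
    (K.toWeakMStructure h ha hb).IsFrame K.A K.B K.C where
  linearIndependent_A := by
    refine LinearIndependent.of_comp (K.rep a b c) ?_
    convert ha using 1
    exact funext (Fin.cases (K.rep_e) fun i => K.rep_A i)
  span_A := by
    refine le_antisymm ?_ fun v hv => ?_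
    · rw [Fin.range_cons, Submodule.span_le, Set.insert_subset_iff]
      exact ⟨K.e_mem_subA, Set.range_subset_iff.2 K.A_mem_subA⟩
    · rw [K.expansion_A hv]
      exact add_mem (sum_mem fun i _ => Submodule.smul_mem _ _ (Submodule.subset_span ⟨i.succ, rfl⟩))
        (Submodule.smul_mem _ _ (Submodule.subset_span ⟨0, rfl⟩))
  linearIndependent_B := by
    refine LinearIndependent.of_comp (K.rep a b c) ?_
    convert hb using 1
    exact funext (Fin.cases (K.rep_e) fun i => K.rep_B i)
  span_B := by
    refine le_antisymm ?_ fun v hv => ?_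
    · rw [Fin.range_cons, Submodule.span_le, Set.insert_subset_iff]
      exact ⟨K.e_mem_subB, Set.range_subset_iff.2 K.B_mem_subB⟩
    · rw [K.expansion_B hv]
      exact add_mem (sum_mem fun i _ => Submodule.smul_mem _ _ (Submodule.subset_span ⟨i.succ, rfl⟩))
        (Submodule.smul_mem _ _ (Submodule.subset_span ⟨0, rfl⟩))
  form_A_B i j := (K.form_right_B _ _).trans ((K.α_A j i).trans (by simp only [eq_comm]))
  form_unit_C := (K.form_right_C _).trans K.γ_e
  form_C_A i := (K.form_right_A _ _).trans (K.β_C i)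
  form_C_B i := (K.form_right_B _ _).trans (K.α_C i)
  form_C_C := (K.form_right_C _).trans K.γ_C

theorem isMStructure (h : s.CentralHolds a b c)
    (ha : LinearIndependent ℂ (Fin.cons 1 a : Fin (p + 1) → X))
    (hb : LinearIndependent ℂ (Fin.cons 1 b : Fin (p + 1) → X)) :
    (K.toWeakMStructure h ha hb).IsMStructure := by
  set S := K.toWeakMStructure h ha hb
  have hr : ∀ v j, S.toU v * S.toU (K.A j) = S.toU (K.ract s v (K.A j)) := fun v j =>
    (S.toU_ract v ⟨K.A j, K.A_mem_subA j⟩).symm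
  have hl : ∀ v j, S.toU (K.B j) * S.toU v = S.toU (K.lact s (K.B j) v) := fun v j =>
    (S.toU_lact ⟨K.B j, K.B_mem_subB j⟩ v).symm
  have he : S.toU K.e = 1 := S.toU_unit
  have hU : s.Holds (fun i => S.toU (K.A i)) (fun i => S.toU (K.B i)) (S.toU K.C) := by
    refine ⟨fun i j => ?_, fun i j => ?_, fun i j => ?_⟩
    · simp [hr, mulAA, he]
    · simp [hl, mulBB, he]
    · simp [hr, mulBA, he, apply_ite S.toU]
  refine (K.isFrame h ha hb).isMStructure (fun j => ?_) fun j => ?_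
  · refine sub_eq_zero.1 ((hU.commutator_a j).trans ?_)
    rw [hU.defectA_eq, hr]
    simp [mulCA, he]
  · refine (sub_eq_zero.1 ((hU.commutator_b j).trans ?_)).symm
    rw [hU.defectB_eq, hl]
    simp [mulBC, he]

end MCoordinates

theorem LinearIndependent.comp_of_injOn {V W : Type*} [AddCommGroup V] [Module ℂ V]
    [AddCommGroup W] [Module ℂ W] {ι : Type*} {v : ι → V} (hv : LinearIndependent ℂ v)
    {r : V →ₗ[ℂ] W} (hr : ∀ x ∈ Submodule.span ℂ (Set.range v), r x = 0 → x = 0) :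
    LinearIndependent ℂ (r ∘ v) :=
  hv.map (Submodule.disjoint_def.2 fun x hx h0 => hr x hx h0)

/-- Independent families that satisfy the relations come from a non-degenerate representation of
an `M`-structure. -/
theorem exists_nondegenerateMRep {n p : ℕ} {a b : Fin p → Matrix (Fin n) (Fin n) ℂ}
    {c : Matrix (Fin n) (Fin n) ℂ} {s : MConstants p} (h : s.CentralHolds a b c)
    (ha : LinearIndependent ℂ (Fin.cons 1 a : Fin (p + 1) → Matrix (Fin n) (Fin n) ℂ))
    (hb : LinearIndependent ℂ (Fin.cons 1 b : Fin (p + 1) → Matrix (Fin n) (Fin n) ℂ)) :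
    ∃ (Z : NondegenerateMRep.{u} n) (A B : Fin p → Z.L) (C : Z.L), Z.str.IsFrame A B C ∧
      (∀ i, Z.rep (Z.str.toU (A i)) = a i) ∧ (∀ i, Z.rep (Z.str.toU (B i)) = b i) ∧
      Z.rep (Z.str.toU C) = c := by
  let K := MCoordinates.model.{u} p
  let S := K.toWeakMStructure h ha hb
  obtain ⟨ρ, hρ, -⟩ := S.existsUnique_lift (K.rep a b c) K.rep_e
    (fun x v => K.rep_lact h v x.2) fun v x => K.rep_ract h v x.2
  have hnd : WeakMStructure.IsNondegenerate ρ := by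
    intro F
    constructor
    · have := F.linearIndependent_A.comp_of_injOn (r := K.rep a b c) fun x hx h0 =>
        K.eq_zero_of_rep_subA ha (F.span_A.le hx : x ∈ S.subA) h0
      have heq : (Fin.cons 1 (fun i => ρ (S.toU (F.A i))) : Fin (F.p + 1) → _) =
          K.rep a b c ∘ (Fin.cons S.unit F.A : Fin (F.p + 1) → _) :=
        funext (Fin.cases K.rep_e.symm fun i => hρ _)
      rw [heq]
      exact this
    · have := F.linearIndependent_B.comp_of_injOn (r := K.rep a b c) fun x hx h0 =>
        K.eq_zero_of_rep_subB hb (F.span_B.le hx : x ∈ S.subB) h0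
      have heq : (Fin.cons 1 (fun i => ρ (S.toU (F.B i))) : Fin (F.p + 1) → _) =
          K.rep a b c ∘ (Fin.cons S.unit F.B : Fin (F.p + 1) → _) :=
        funext (Fin.cases K.rep_e.symm fun i => hρ _)
      rw [heq]
      exact this
  have : FiniteDimensional ℂ (ULift.{u} ((Fin p → ℂ) × (Fin p → ℂ) × ℂ × ℂ)) :=
    ULift.moduleEquiv.symm.finiteDimensional
  refine ⟨⟨_, S, K.isMStructure h ha hb, ρ, hnd⟩, K.A, K.B, K.C, K.isFrame h ha hb,
    fun i => ?_, fun i => ?_, ?_⟩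
  · exact (hρ _).trans (K.rep_A i)
  · exact (hρ _).trans (K.rep_B i)
  · exact (hρ _).trans K.rep_C

/-! ### A representation is determined by its product -/

section Matching

variable {n p q : ℕ} {a b : Fin p → Matrix (Fin n) (Fin n) ℂ} {c : Matrix (Fin n) (Fin n) ℂ}
  {a' b' : Fin q → Matrix (Fin n) (Fin n) ℂ} {c' : Matrix (Fin n) (Fin n) ℂ}

/-- If `x ↦ ∑ aᵢ x bⁱ + c x` and `x ↦ ∑ a'ᵢ x b'ⁱ + c' x` define the same product, then
`1, a'ᵢ` and `1, b'ⁱ` span the `aⱼ` and the `bʲ`, with mutually inverse transition matrices. -/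
theorem exists_transition [NeZero n]
    (ha : LinearIndependent ℂ (Fin.cons 1 a : Fin (p + 1) → Matrix (Fin n) (Fin n) ℂ))
    (hb : LinearIndependent ℂ (Fin.cons 1 b : Fin (p + 1) → Matrix (Fin n) (Fin n) ℂ))
    (h : coboundary (frameMap a b c) = coboundary (frameMap a' b' c')) :
    ∃ (P Q : Fin p → Fin q → ℂ) (r t : Fin p → ℂ),
      (∀ j, a j = ∑ i, P j i • a' i + r j • (1 : Matrix (Fin n) (Fin n) ℂ)) ∧
      (∀ j, b j = ∑ i, Q j i • b' i + t j • (1 : Matrix (Fin n) (Fin n) ℂ)) ∧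
      ∀ j k, ∑ i, P j i * Q k i = if j = k then 1 else 0 := by
  obtain ⟨d, hd⟩ := exists_sub_eq_commutator h
  have hlin : ∑ i, LinearMap.mulLeftRight ℂ (a i, b i) + LinearMap.mulLeftRight ℂ (c, 1)
      - (∑ i, LinearMap.mulLeftRight ℂ (a' i, b' i) + LinearMap.mulLeftRight ℂ (c', 1)) =
      LinearMap.mulLeftRight ℂ (1, d) - LinearMap.mulLeftRight ℂ (d, 1) := by
    refine LinearMap.ext fun x => ?_
    simpa [frameMap_apply] using hd x
  obtain ⟨f, hf1, hf⟩ := exists_dual_functional ha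
  obtain ⟨g, hg1, hg⟩ := exists_dual_functional hb
  have hF := fun j => congrArg (contractFst (f j)) hlin
  have hG := fun j => congrArg (contractSnd (g j)) hlin
  simp only [map_add, map_sub, map_sum, contractFst_mulLeftRight, hf, hf1, ite_smul, one_smul,
    zero_smul, Finset.sum_ite_eq, Finset.mem_univ, if_true, zero_sub] at hF
  simp only [map_add, map_sub, map_sum, contractSnd_mulLeftRight, hg, hg1, ite_smul, one_smul,
    zero_smul, Finset.sum_ite_eq, Finset.mem_univ, if_true, sub_zero, add_zero] at hG
  refine ⟨fun j i => g j (b' i), fun j i => f j (a' i), fun j => g j d,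
    fun j => f j c' - f j c - f j d, fun j => ?_, fun j => ?_, fun j k => ?_⟩
  · rw [← hG j]
    abel
  · rw [sub_smul, sub_smul, sub_eq_add_neg _ (f j d • _), ← hF j]
    abel
  · have := congrArg (f k) (hG j)
    simp only [map_sub, map_sum, map_smul, hf, hf1, smul_eq_mul, mul_zero] at this
    rw [← sub_eq_zero.1 this]
    simp only [eq_comm]

theorem card_le_of_coboundary_eq [NeZero n]
    (ha : LinearIndependent ℂ (Fin.cons 1 a : Fin (p + 1) → Matrix (Fin n) (Fin n) ℂ))
    (hb : LinearIndependent ℂ (Fin.cons 1 b : Fin (p + 1) → Matrix (Fin n) (Fin n) ℂ))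
    (h : coboundary (frameMap a b c) = coboundary (frameMap a' b' c')) : p ≤ q := by
  obtain ⟨P, -, r, -, hP, -⟩ := exists_transition ha hb h
  have h1 : Submodule.span ℂ (Set.range (Fin.cons 1 a : Fin (p + 1) → Matrix (Fin n) (Fin n) ℂ)) ≤
      Submodule.span ℂ (Set.range (Fin.cons 1 a' : Fin (q + 1) → Matrix (Fin n) (Fin n) ℂ)) := by
    rw [Fin.range_cons, Submodule.span_le, Set.insert_subset_iff]
    refine ⟨Submodule.subset_span ⟨0, rfl⟩, Set.range_subset_iff.2 fun j => ?_⟩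
    rw [hP j]
    exact add_mem (sum_mem fun i _ => Submodule.smul_mem _ _ (Submodule.subset_span ⟨i.succ, rfl⟩))
      (Submodule.smul_mem _ _ (Submodule.subset_span ⟨0, rfl⟩))
  have h2 := Submodule.finrank_mono h1
  have h3 := finrank_range_le_card (R := ℂ)
    (Fin.cons 1 a' : Fin (q + 1) → Matrix (Fin n) (Fin n) ℂ)
  rw [Set.finrank] at h3
  rw [finrank_span_eq_card ha] at h2
  simp only [Fintype.card_fin] at h2 h3
  omega

end Matching

namespace WeakMStructure

section Transfer

variable {L : Type u} [AddCommGroup L] [Module ℂ L] {S : WeakMStructure L}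
  {L' : Type v} [AddCommGroup L'] [Module ℂ L'] {S' : WeakMStructure L'}
  {p : ℕ} {A B : Fin p → L} {C : L} {A' B' : Fin p → L'} {C' : L'}

theorem IsNondegenerate.linearIndependent {n : ℕ} {ρ : S.U →ₐ[ℂ] Matrix (Fin n) (Fin n) ℂ}
    (hρ : IsNondegenerate ρ) (h : S.IsFrame A B C) :
    LinearIndependent ℂ
      (Fin.cons 1 (fun i => ρ (S.toU (A i))) : Fin (p + 1) → Matrix (Fin n) (Fin n) ℂ) ∧
    LinearIndependent ℂ
      (Fin.cons 1 (fun i => ρ (S.toU (B i))) : Fin (p + 1) → Matrix (Fin n) (Fin n) ℂ) :=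
  hρ h.toFrame

theorem IsNondegenerate.eq_zero_of_mem_subA {n : ℕ} {ρ : S.U →ₐ[ℂ] Matrix (Fin n) (Fin n) ℂ}
    (hρ : IsNondegenerate ρ) (h : S.IsFrame A B C) {v : L} (hv : v ∈ S.subA)
    (h0 : ρ (S.toU v) = 0) : v = 0 := by
  rw [← h.span_A] at hv
  obtain ⟨s, rfl⟩ := (Submodule.mem_span_range_iff_exists_fun ℂ).1 hv
  have h1 := Fintype.linearIndependent_iff.1 (hρ.linearIndependent h).1 s (by
    simpa [Fin.sum_univ_succ, toU_unit] using h0)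
  exact Finset.sum_eq_zero fun i _ => by rw [h1 i, zero_smul]

theorem IsNondegenerate.eq_zero_of_mem_subB {n : ℕ} {ρ : S.U →ₐ[ℂ] Matrix (Fin n) (Fin n) ℂ}
    (hρ : IsNondegenerate ρ) (h : S.IsFrame A B C) {v : L} (hv : v ∈ S.subB)
    (h0 : ρ (S.toU v) = 0) : v = 0 := by
  rw [← h.span_B] at hv
  obtain ⟨s, rfl⟩ := (Submodule.mem_span_range_iff_exists_fun ℂ).1 hv
  have h1 := Fintype.linearIndependent_iff.1 (hρ.linearIndependent h).2 s (by
    simpa [Fin.sum_univ_succ, toU_unit] using h0)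
  exact Finset.sum_eq_zero fun i _ => by rw [h1 i, zero_smul]

/-- The linear map of a weak `M`-structure to another that maps a frame `A, B, C` to a frame
`A', B', C'`. -/
noncomputable def transfer (S : WeakMStructure L) (S' : WeakMStructure L') (A B : Fin p → L)
    (C : L) (A' B' : Fin p → L') (C' : L') : L →ₗ[ℂ] L' :=
  ∑ j, (S.form (B j)).smulRight (A' j) + ∑ j, (S.form (A j)).smulRight (B' j)
    + (S.form C).smulRight S'.unit + (S.form S.unit).smulRight C'

theorem transfer_apply (v : L) : transfer S S' A B C A' B' C' v =
    ∑ j, S.form v (B j) • A' j + ∑ j, S.form v (A j) • B' j + S.form v C • S'.unit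
      + S.form v S.unit • C' := by
  simp [transfer, S.form_symm v]

namespace IsFrame

/-- The transfer preserves the coordinates. -/
theorem form_transfer_frame (h' : S'.IsFrame A' B' C') (v : L) :
    (∀ i, S'.form (transfer S S' A B C A' B' C' v) (A' i) = S.form v (A i)) ∧
    (∀ i, S'.form (transfer S S' A B C A' B' C' v) (B' i) = S.form v (B i)) ∧
    S'.form (transfer S S' A B C A' B' C' v) C' = S.form v C ∧
    S'.form (transfer S S' A B C A' B' C' v) S'.unit = S.form v S.unit := by
  obtain ⟨h1, h2, h3, h4, h5, h6, h7, h8, h9, h10, h11⟩ := h'.form_table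
  refine ⟨fun i => ?_, fun i => ?_, ?_, ?_⟩
  all_goals simp [transfer_apply, h'.form_A_B, h'.form_unit_C, h'.form_C_A, h'.form_C_B,
    h'.form_C_C, h1, h2, h3, h4, h5, h6, h7, h8, h9, h10, h11]

theorem form_transfer (h : S.IsFrame A B C) (h' : S'.IsFrame A' B' C') (v w : L) :
    S'.form (transfer S S' A B C A' B' C' v) (transfer S S' A B C A' B' C' w) = S.form v w := by
  obtain ⟨h1, h2, h3, h4⟩ := h'.form_transfer_frame (S := S) (A := A) (B := B) (C := C) v
  rw [transfer_apply w]
  simp only [map_add, map_sum, map_smul, h1, h2, h3, h4]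
  conv_rhs => rw [h.expansion w]
  simp

theorem transfer_transfer (h : S.IsFrame A B C) (h' : S'.IsFrame A' B' C') (v : L) :
    transfer S' S A' B' C' A B C (transfer S S' A B C A' B' C' v) = v := by
  obtain ⟨h1, h2, h3, h4⟩ := h'.form_transfer_frame (S := S) (A := A) (B := B) (C := C) v
  rw [transfer_apply]
  simp only [h1, h2, h3, h4]
  exact (h.expansion v).symm

theorem transfer_mem_subA (h : S.IsFrame A B C) (h' : S'.IsFrame A' B' C') {v : L}
    (hv : v ∈ S.subA) : transfer S S' A B C A' B' C' v ∈ S'.subA := by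
  simp only [transfer_apply, form_eq_zero_of_mem_subA hv (h.A_mem _),
    form_eq_zero_of_mem_subA hv S.unit_mem_subA, zero_smul, Finset.sum_const_zero, add_zero]
  exact add_mem (sum_mem fun i _ => Submodule.smul_mem _ _ (h'.A_mem i))
    (Submodule.smul_mem _ _ S'.unit_mem_subA)

theorem transfer_mem_subB (h : S.IsFrame A B C) (h' : S'.IsFrame A' B' C') {v : L}
    (hv : v ∈ S.subB) : transfer S S' A B C A' B' C' v ∈ S'.subB := by
  simp only [transfer_apply, form_eq_zero_of_mem_subB hv (h.B_mem _),
    form_eq_zero_of_mem_subB hv S.unit_mem_subB, zero_smul, Finset.sum_const_zero, add_zero,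
    zero_add]
  exact add_mem (sum_mem fun i _ => Submodule.smul_mem _ _ (h'.B_mem i))
    (Submodule.smul_mem _ _ S'.unit_mem_subB)

theorem transfer_unit (h : S.IsFrame A B C) :
    transfer S S' A B C A' B' C' S.unit = S'.unit := by
  obtain ⟨h1, h2, h3, h4, h5, h6, h7, h8, h9, h10, h11⟩ := h.form_table
  simp [transfer_apply, h6, h7, h.form_unit_C, h11]

/-- Weak `M`-structures with non-degenerate representations whose frames have the same images are
isomorphic. -/
theorem exists_iso {n : ℕ} {ρ : S.U →ₐ[ℂ] Matrix (Fin n) (Fin n) ℂ}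
    {ρ' : S'.U →ₐ[ℂ] Matrix (Fin n) (Fin n) ℂ} (hρ' : IsNondegenerate ρ')
    (h : S.IsFrame A B C) (h' : S'.IsFrame A' B' C')
    (hA : ∀ i, ρ' (S'.toU (A' i)) = ρ (S.toU (A i)))
    (hB : ∀ i, ρ' (S'.toU (B' i)) = ρ (S.toU (B i)))
    (hC : ρ' (S'.toU C') = ρ (S.toU C)) :
    ∃ e : Iso S S', ∀ v, ρ' (S'.toU (e.toLinearEquiv v)) = ρ (S.toU v) := by
  let e : L ≃ₗ[ℂ] L' := LinearEquiv.ofLinearMap (transfer S S' A B C A' B' C')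
    (transfer S' S A' B' C' A B C)
    (LinearMap.ext fun v => h'.transfer_transfer h v)
    (LinearMap.ext fun v => h.transfer_transfer h' v)
  have hform : ∀ v w, S'.form (e v) (e w) = S.form v w := h.form_transfer h'
  have hmA : ∀ v, v ∈ S.subA ↔ e v ∈ S'.subA := fun v =>
    ⟨h.transfer_mem_subA h', fun hv => by
      have := h'.transfer_mem_subA h hv
      rwa [show transfer S' S A' B' C' A B C (e v) = v from h.transfer_transfer h' v] at this⟩
  have hmB : ∀ v, v ∈ S.subB ↔ e v ∈ S'.subB := fun v =>
    ⟨h.transfer_mem_subB h', fun hv => by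
      have := h'.transfer_mem_subB h hv
      rwa [show transfer S' S A' B' C' A B C (e v) = v from h.transfer_transfer h' v] at this⟩
  have hrep : ∀ v, ρ' (S'.toU (e v)) = ρ (S.toU v) := by
    intro v
    have h1 : e v = _ := transfer_apply v
    rw [h1]
    conv_rhs => rw [h.expansion v]
    simp only [map_add, map_sum, map_smul, hA, hB, hC, S.toU_unit, S'.toU_unit, map_one]
  have hmulA : ∀ a a' : S.subA, e (S.mulA a a' : L) =
      S'.mulA ⟨e a, (hmA a).1 a.2⟩ ⟨e a', (hmA a').1 a'.2⟩ := by
    intro a a'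
    rw [← sub_eq_zero]
    refine hρ'.eq_zero_of_mem_subA h' (sub_mem ((hmA _).1 (S.mulA a a').2) (Subtype.prop _)) ?_
    rw [map_sub, map_sub, hrep, ← S.ract_eq_mulA, ← S'.ract_eq_mulA, S.toU_ract, S'.toU_ract,
      map_mul, map_mul, hrep, hrep, sub_self]
  have hmulB : ∀ b b' : S.subB, e (S.mulB b b' : L) =
      S'.mulB ⟨e b, (hmB b).1 b.2⟩ ⟨e b', (hmB b').1 b'.2⟩ := by
    intro b b'
    rw [← sub_eq_zero]
    refine hρ'.eq_zero_of_mem_subB h' (sub_mem ((hmB _).1 (S.mulB b b').2) (Subtype.prop _)) ?_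
    rw [map_sub, map_sub, hrep, ← S.lact_eq_mulB, ← S'.lact_eq_mulB, S.toU_lact, S'.toU_lact,
      map_mul, map_mul, hrep, hrep, sub_self]
  -- an element orthogonal to `𝒜'` lies in `𝒜'`, and vanishes if its image does
  have hract : ∀ (v : L) (a : S.subA), e (S.ract v a) = S'.ract (e v) ⟨e a, (hmA a).1 a.2⟩ := by
    intro v a
    rw [← sub_eq_zero]
    refine hρ'.eq_zero_of_mem_subA h' ((h'.mem_subA_iff _).2 fun x hx => ?_) ?_
    · obtain ⟨y, rfl⟩ := e.surjective x
      have hy := (hmA y).2 hx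
      have h1 := S.form_mulA v a ⟨y, hy⟩
      have h2 := S'.form_mulA (e v) ⟨e a, (hmA a).1 a.2⟩ ⟨e y, hx⟩
      rw [← hmulA a ⟨y, hy⟩, hform] at h2
      rw [map_sub, LinearMap.sub_apply, hform, ← h2, ← h1, sub_self]
    · rw [map_sub, map_sub, hrep, S.toU_ract, S'.toU_ract, map_mul, map_mul, hrep, hrep, sub_self]
  have hlact : ∀ (b : S.subB) (v : L), e (S.lact b v) = S'.lact ⟨e b, (hmB b).1 b.2⟩ (e v) := by
    intro b v
    rw [← sub_eq_zero]
    refine hρ'.eq_zero_of_mem_subB h' ((h'.mem_subB_iff _).2 fun x hx => ?_) ?_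
    · obtain ⟨y, rfl⟩ := e.surjective x
      have hy := (hmB y).2 hx
      have h1 := S.form_mulB ⟨y, hy⟩ b v
      have h2 := S'.form_mulB ⟨e y, hx⟩ ⟨e b, (hmB b).1 b.2⟩ (e v)
      rw [← hmulB ⟨y, hy⟩ b, hform] at h2
      rw [S'.form_symm, map_sub, hform, ← h2, ← h1, sub_self]
    · rw [map_sub, map_sub, hrep, S.toU_lact, S'.toU_lact, map_mul, map_mul, hrep, hrep, sub_self]
  exact ⟨⟨e, hmA, hmB, h.transfer_unit, hform, hmulA, hmulB, hlact, hract⟩, hrep⟩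

end IsFrame

end Transfer

end WeakMStructure

open WeakMStructure in
/-- Non-degenerate representations that define the same product are equivalent. -/
theorem NondegenerateMRep.equivalent_of_coboundary_eq {n : ℕ} [NeZero n]
    {Y Z : NondegenerateMRep.{u} n} {p q : ℕ} {A B : Fin p → Y.L} {C : Y.L}
    {A' B' : Fin q → Z.L} {C' : Z.L} (hY : Y.str.IsFrame A B C) (hZ : Z.str.IsFrame A' B' C')
    (h : coboundary (frameMap (fun i => Y.rep (Y.str.toU (A i)))
        (fun i => Y.rep (Y.str.toU (B i))) (Y.rep (Y.str.toU C))) =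
      coboundary (frameMap (fun i => Z.rep (Z.str.toU (A' i)))
        (fun i => Z.rep (Z.str.toU (B' i))) (Z.rep (Z.str.toU C')))) :
    Y.Equivalent Z := by
  obtain ⟨ha, hb⟩ := Y.isNondegenerate.linearIndependent hY
  obtain ⟨ha', hb'⟩ := Z.isNondegenerate.linearIndependent hZ
  obtain rfl : p = q := le_antisymm (card_le_of_coboundary_eq ha hb h)
    (card_le_of_coboundary_eq ha' hb' h.symm)
  obtain ⟨P, Q, r, t, hP, hQ, hPQ⟩ := exists_transition ha hb h
  -- the vectors of `Z` with the same images as the frame of `Y`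
  let A'' : Fin p → Z.L := fun j => ∑ i, P j i • A' i + r j • Z.str.unit
  let B'' : Fin p → Z.L := fun j => ∑ i, Q j i • B' i + t j • Z.str.unit
  have hA : ∀ j, Z.rep (Z.str.toU (A'' j)) = Y.rep (Y.str.toU (A j)) := by
    intro j
    rw [hP j]
    simp [A'', toU_unit]
  have hB : ∀ j, Z.rep (Z.str.toU (B'' j)) = Y.rep (Y.str.toU (B j)) := by
    intro j
    rw [hQ j]
    simp [B'', toU_unit]
  have hmA : ∀ j, A'' j ∈ Z.str.subA := fun j =>
    add_mem (sum_mem fun i _ => Submodule.smul_mem _ _ (hZ.A_mem i))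
      (Submodule.smul_mem _ _ Z.str.unit_mem_subA)
  have hmB : ∀ j, B'' j ∈ Z.str.subB := fun j =>
    add_mem (sum_mem fun i _ => Submodule.smul_mem _ _ (hZ.B_mem i))
      (Submodule.smul_mem _ _ Z.str.unit_mem_subB)
  have hliA : LinearIndependent ℂ (Fin.cons Z.str.unit A'' : Fin (p + 1) → Z.L) := by
    refine LinearIndependent.of_comp (Z.rep.toLinearMap ∘ₗ Z.str.toU) ?_
    have heq : (Z.rep.toLinearMap ∘ₗ Z.str.toU) ∘ (Fin.cons Z.str.unit A'' : Fin (p + 1) → Z.L) =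
        (Fin.cons 1 fun i => Y.rep (Y.str.toU (A i)) : Fin (p + 1) → _) :=
      funext (Fin.cases (by simp [toU_unit]) hA)
    rw [heq]
    exact ha
  have hliB : LinearIndependent ℂ (Fin.cons Z.str.unit B'' : Fin (p + 1) → Z.L) := by
    refine LinearIndependent.of_comp (Z.rep.toLinearMap ∘ₗ Z.str.toU) ?_
    have heq : (Z.rep.toLinearMap ∘ₗ Z.str.toU) ∘ (Fin.cons Z.str.unit B'' : Fin (p + 1) → Z.L) =
        (Fin.cons 1 fun i => Y.rep (Y.str.toU (B i)) : Fin (p + 1) → _) :=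
      funext (Fin.cases (by simp [toU_unit]) hB)
    rw [heq]
    exact hb
  have hsA : Submodule.span ℂ (Set.range (Fin.cons Z.str.unit A'' : Fin (p + 1) → Z.L)) =
      Z.str.subA := by
    refine Submodule.eq_of_le_of_finrank_eq ?_ ?_
    · rw [Fin.range_cons, Submodule.span_le, Set.insert_subset_iff]
      exact ⟨Z.str.unit_mem_subA, Set.range_subset_iff.2 hmA⟩
    · rw [finrank_span_eq_card hliA, ← hZ.span_A, finrank_span_eq_card hZ.linearIndependent_A]
  have hsB : Submodule.span ℂ (Set.range (Fin.cons Z.str.unit B'' : Fin (p + 1) → Z.L)) =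
      Z.str.subB := by
    refine Submodule.eq_of_le_of_finrank_eq ?_ ?_
    · rw [Fin.range_cons, Submodule.span_le, Set.insert_subset_iff]
      exact ⟨Z.str.unit_mem_subB, Set.range_subset_iff.2 hmB⟩
    · rw [finrank_span_eq_card hliB, ← hZ.span_B, finrank_span_eq_card hZ.linearIndependent_B]
  have hform : ∀ j k, Z.str.form (A'' j) (B'' k) = if j = k then 1 else 0 := by
    intro j k
    obtain ⟨h1, h2, h3, h4, h5, h6, h7, h8, h9, h10, h11⟩ := hZ.form_table
    rw [← hPQ j k]
    simp [A'', B'', hZ.form_A_B, h4, h7, h11]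
  obtain ⟨C'', hC''⟩ := exists_isFrame_of_dual hliA hsA hliB hsB hform
  -- the product does not depend on the frame, and its value at `(1, 1)` determines `c`
  have hC : Z.rep (Z.str.toU C'') = Y.rep (Y.str.toU C) := by
    have h1 := hZ.coboundary_eq hC'' (Z.rep.toLinearMap ∘ₗ Z.str.toU) (by simp [toU_unit])
    have h2 := LinearMap.congr_fun (LinearMap.congr_fun (h1.trans h.symm) 1) 1
    simpa [coboundary_apply, frameMap_apply, hA, hB] using h2
  exact hY.exists_iso Z.isNondegenerate hC'' hA hB hC

/-! ### The correspondence -/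

namespace NondegenerateMRep

variable {n : ℕ}

/-- The product of a non-degenerate representation, computed in a chosen frame. -/
theorem exists_product (Z : NondegenerateMRep.{u} n) :
    ∃ m : CompatibleMatrixProduct n, ∀ (p : ℕ) (A B : Fin p → Z.L) (C : Z.L),
      Z.str.IsFrame A B C → m.1 = coboundary (frameMap (fun i => Z.rep (Z.str.toU (A i)))
        (fun i => Z.rep (Z.str.toU (B i))) (Z.rep (Z.str.toU C))) := by
  obtain ⟨p, A, B, C, hF⟩ := Z.str.exists_isFrame
  have hassoc := hF.isAssociative Z.isMStructure Z.rep
  refine ⟨⟨_, hassoc, (isCompatible_mul_iff hassoc).2 (isTwoCocycle_coboundary _)⟩,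
    fun q A' B' C' hF' => ?_⟩
  exact hF'.coboundary_eq hF (Z.rep.toLinearMap ∘ₗ Z.str.toU)
    (by simp [WeakMStructure.toU_unit])

/-- The compatible product defined by a non-degenerate representation. -/
noncomputable def product (Z : NondegenerateMRep.{u} n) : CompatibleMatrixProduct n :=
  Z.exists_product.choose

theorem product_eq (Z : NondegenerateMRep.{u} n) {p : ℕ} {A B : Fin p → Z.L} {C : Z.L}
    (h : Z.str.IsFrame A B C) : Z.product.1 =
      coboundary (frameMap (fun i => Z.rep (Z.str.toU (A i)))
        (fun i => Z.rep (Z.str.toU (B i))) (Z.rep (Z.str.toU C))) :=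
  Z.exists_product.choose_spec p A B C h

/-- Isomorphisms of weak `M`-structures map frames to frames. -/
theorem _root_.WeakMStructure.IsFrame.map {L : Type u} [AddCommGroup L] [Module ℂ L]
    {L' : Type v} [AddCommGroup L'] [Module ℂ L'] {S : WeakMStructure L} {S' : WeakMStructure L'}
    (e : WeakMStructure.Iso S S') {p : ℕ} {A B : Fin p → L} {C : L} (h : S.IsFrame A B C) :
    S'.IsFrame (fun i => e.toLinearEquiv (A i)) (fun i => e.toLinearEquiv (B i))
      (e.toLinearEquiv C) := by
  have hcons : ∀ D : Fin p → L, (Fin.cons S'.unit (fun i => e.toLinearEquiv (D i)) :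
      Fin (p + 1) → L') = e.toLinearEquiv ∘ (Fin.cons S.unit D : Fin (p + 1) → L) := fun D =>
    funext (Fin.cases e.map_unit.symm fun i => rfl)
  have hli : ∀ D : Fin p → L, LinearIndependent ℂ (Fin.cons S.unit D : Fin (p + 1) → L) →
      LinearIndependent ℂ (Fin.cons S'.unit (fun i => e.toLinearEquiv (D i)) :
        Fin (p + 1) → L') := by
    intro D hD
    rw [hcons]
    exact hD.map' e.toLinearEquiv.toLinearMap e.toLinearEquiv.ker
  have hspan : ∀ D : Fin p → L, Submodule.span ℂ (Set.range
      (Fin.cons S'.unit (fun i => e.toLinearEquiv (D i)) : Fin (p + 1) → L')) =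
      (Submodule.span ℂ (Set.range (Fin.cons S.unit D : Fin (p + 1) → L))).map
        e.toLinearEquiv.toLinearMap := by
    intro D
    rw [hcons, Set.range_comp, Submodule.map_span]
    rfl
  refine ⟨hli A h.linearIndependent_A, ?_, hli B h.linearIndependent_B, ?_, fun i j => ?_, ?_,
    fun i => ?_, fun i => ?_, ?_⟩
  · rw [hspan, h.span_A]
    ext v
    obtain ⟨w, rfl⟩ := e.toLinearEquiv.surjective v
    rw [← e.mem_subA]
    simp
  · rw [hspan, h.span_B]
    ext v
    obtain ⟨w, rfl⟩ := e.toLinearEquiv.surjective v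
    rw [← e.mem_subB]
    simp
  · rw [e.map_form, h.form_A_B]
  · rw [← e.map_unit, e.map_form, h.form_unit_C]
  · rw [e.map_form, h.form_C_A]
  · rw [e.map_form, h.form_C_B]
  · rw [e.map_form, h.form_C_C]

theorem Equivalent.product_eq {Y Z : NondegenerateMRep.{u} n} (h : Y.Equivalent Z) :
    Y.product = Z.product := by
  obtain ⟨e, he⟩ := h
  obtain ⟨p, A, B, C, hF⟩ := Y.str.exists_isFrame
  apply Subtype.ext
  rw [Y.product_eq hF, Z.product_eq (hF.map e)]
  simp only [he]

theorem equivalent_of_product_eq [NeZero n] {Y Z : NondegenerateMRep.{u} n}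
    (h : Y.product = Z.product) : Y.Equivalent Z := by
  obtain ⟨p, A, B, C, hY⟩ := Y.str.exists_isFrame
  obtain ⟨q, A', B', C', hZ⟩ := Z.str.exists_isFrame
  refine equivalent_of_coboundary_eq hY hZ ?_
  rw [← Y.product_eq hY, ← Z.product_eq hZ, h]

theorem product_surjective [NeZero n] :
    Function.Surjective (product : NondegenerateMRep.{u} n → CompatibleMatrixProduct n) := by
  rintro ⟨m, hassoc, hcompat⟩
  obtain ⟨p, a, b, c, ha, hb, rfl⟩ :=
    exists_eq_coboundary_frameMap m ((isCompatible_mul_iff hassoc).1 hcompat)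
  obtain ⟨s, hs⟩ := exists_holds ha hb hassoc
  obtain ⟨hA, hB⟩ := hs.defect_eq_zero ha hb hassoc
  obtain ⟨Z, A, B, C, hF, hZA, hZB, hZC⟩ := exists_nondegenerateMRep.{u} ⟨hs, hA, hB⟩ ha hb
  refine ⟨Z, Subtype.ext ?_⟩
  rw [Z.product_eq hF]
  simp only [hZA, hZB, hZC]

end NondegenerateMRep

/-- For `n ≥ 1`, the formula `x ∘ y = a_i x b^i y + x a_i y b^i - a_i x y b^i + x c y` gives a
bijection from the `n`-dimensional non-degenerate representations of the algebras `U(L)` of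
`M`-structures `L`, up to equivalence of `M`-structures, onto the associative products on `Mat_n`
compatible with the matrix product. -/
theorem theorem2p3 (n : ℕ) (hn : 1 ≤ n) :
    ∃ Φ : Quotient (NondegenerateMRep.setoid.{u} n) ≃ CompatibleMatrixProduct n,
      ∀ X : NondegenerateMRep.{u} n,
        Nonempty X.str.Frame ∧
        ∀ (F : X.str.Frame) (x y : Matrix (Fin n) (Fin n) ℂ),
          (Φ (Quotient.mk (NondegenerateMRep.setoid.{u} n) X)).1 x y = F.product X.rep x y := by
  have : NeZero n := ⟨Nat.one_le_iff_ne_zero.1 hn⟩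
  let Ψ : Quotient (NondegenerateMRep.setoid.{u} n) → CompatibleMatrixProduct n :=
    Quotient.lift NondegenerateMRep.product fun _ _ h => NondegenerateMRep.Equivalent.product_eq h
  have hΨ : Function.Bijective Ψ := by
    constructor
    · rintro ⟨Y⟩ ⟨Z⟩ h
      exact Quotient.sound (NondegenerateMRep.equivalent_of_product_eq h)
    · intro m
      obtain ⟨Z, rfl⟩ := NondegenerateMRep.product_surjective m
      exact ⟨Quotient.mk _ Z, rfl⟩
  refine ⟨Equiv.ofBijective Ψ hΨ, fun X => ⟨?_, fun F x y => ?_⟩⟩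
  · obtain ⟨p, A, B, C, hF⟩ := X.str.exists_isFrame
    exact ⟨hF.toFrame⟩
  · rw [F.product_eq]
    exact LinearMap.congr_fun (LinearMap.congr_fun (X.product_eq F.isFrame) x) y
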